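/- Setting. For each sample size $n$ let $p=p_n$ be an integer with $p_n\to\infty$, let $1\le k=k_n<n$ with $\theta=\theta_{nk}=k/n\to\theta^0\in(0,1)$, let $\mathbf X_i=\mathbf X_{n,i}\in\mathbb R^p$ $(1\le i\le n)$ be deterministic, and let $$Y_i=\mathbf X_i^t\beta^0+\varepsilon_i\ (1\le i\le k),\qquad Y_i=\mathbf X_i^t\beta_2+\varepsilon_i\ (k<i\le n),$$ where $(\varepsilon_i)$ are i.i.d. with mean zero and finite variance $\sigma^2$. The null hypothesis $H_0$ is $\beta_2=\beta^0$. Put $\mathbf z_i(\beta)=\mathbf X_i(Y_i-\mathbf X_i^t\beta)$, $\mathbf z_i^0=\mathbf X_i\varepsilon_i$, and $$\psi_n^0=\frac1{n\theta}\sum_{i=1}^k\mathbf z_i^0-\frac1{n(1-\theta)}\sum_{j=k+1}^n\mathbf z_j^0,\qquad \mathbf S_n^0=\frac1{n\theta^2}\sum_{i=1}^k\mathbf z_i^0\mathbf z_i^{0t}+\frac1{n(1-\theta)^2}\sum_{j=k+1}^n\mathbf z_j^0\mathbf z_j^{0t},$$ $$\mathbf V_n^0=\frac1{n\theta^2}\sum_{i=1}^k\sigma^2\mathbf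 X_i\mathbf X_i^t+\frac1{n(1-\theta)^2}\sum_{j=k+1}^n\sigma^2\mathbf X_j\mathbf X_j^t .$$ With $\mathbf w_i^0=(\mathbf V_n^0)^{-1/2}\mathbf z_i(\beta^0)$ put, for $t_1,\dots,t_r\in\{1,\dots,p\}$, $$\alpha^{t_1\cdots t_r}=\frac1{n\theta^r}\sum_{i=1}^k\mathbb E[w^0_{i,t_1}\cdots w^0_{i,t_r}]+\frac1{n(\theta-1)^r}\sum_{j=k+1}^n\mathbb E[w^0_{j,t_1}\cdots w^0_{j,t_r}].$$ The empirical likelihood ratio statistic is $$\mathrm{EL}_{nk}(\beta)=2\sum_{i=1}^k\log\Big(1+\frac nk\lambda^t\mathbf z_i(\beta)\Big)+2\sum_{j=k+1}^n\log\Big(1-\frac n{n-k}\lambda^t\mathbf z_j(\beta)\Big),$$ where the Lagrange multiplier $\lambda=\lambda(\beta)\in\mathbb R^p$ is such that $k/n+\lambda^t\mathbf z_i(\beta)>0$ for $i\le k$ and $1-k/n-\lambda^t\mathbf z_j(\beta)>0$ for $j>k$, and solves $$\sum_{i=1}^k\frac{\mathbf z_i(\beta)}{k/n+\lambda^t\mathbf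 z_i(\beta)}-\sum_{j=k+1}^n\frac{\mathbf z_j(\beta)}{1-k/n-\lambda^t\mathbf z_j(\beta)}=\mathbf 0_p$$ (where there is no such $\lambda$, give $\mathrm{EL}_{nk}(\beta)$ an arbitrary value). Assumptions. For some real $q\ge4$ and some constants $C_0,C_1,C_3>0$: (A1) for all large $n$, all eigenvalues of $\mathbf V_n^0$ lie in $(C_0,C_1)$; (A2) $\mathbb E\,\varepsilon_1^4<\infty$; (A3) for all large $n$, $p^{-1}\sum_{s=1}^p|X_{i,s}|^q<C_3$ for $1\le i\le n$; (A4) $\mathbb E|\varepsilon_1|^{2q}<\infty$; (A5) $p\,k^{(2-q)/(2q)}\to0$ and $p\,(n-k)^{(2-q)/(2q)}\to0$; (A6) $p^{2+4/q}k^{-1}\to0$ and $p^{2+4/q}(n-k)^{-1}\to0$; (A7) $\sum_{r,s=1}^p\alpha^{rrss}=O(p^2)$; (A8) $\sum_{r,s,u=1}^p\alpha^{rsu}\alpha^{rsu}=O(p^{5/2})$ and $\sum_{r,s,u=1}^p\alpha^{rss}\alpha^{suu}=O(p^{5/2})$. Proposition. Under (A1)–(A8) and $H_0$, with probability tending to one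 as $n\to\infty$ the multiplier $\lambda(\beta^0)$ exists and is unique and $\mathbf S_n^0$ is invertible, and $$\mathrm{EL}_{nk}(\beta^0)=n\,\psi_n^{0t}(\mathbf S_n^0)^{-1}\psi_n^0+o_{\mathbb P}(p^{1/2}).$$ -/

import Mathlib

open MeasureTheory ProbabilityTheory Filter Topology Matrix Finset Asymptotics
open scoped ENNReal

/-! Observations are numbered from `0`: for a sample of size `n` with change-point `k`, the first
phase consists of the indices in `Finset.range k` and the second one of those in
`Finset.Ico k n`. -/

noncomputable section

namespace TwoSampleEL

section OneSample

variable {p : ℕ}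

/-- The vector `z_i(β) = X_i (Y_i - X_iᵗ β)`. -/
def score (x : ℕ → Fin p → ℝ) (y : ℕ → ℝ) (β : Fin p → ℝ) (i : ℕ) : Fin p → ℝ :=
  (y i - x i ⬝ᵥ β) • x i

/-- The location `θ = k / n` of the change-point. -/
def theta (n k : ℕ) : ℝ := (k : ℝ) / (n : ℝ)

/-- The vector `ψ = (nθ)⁻¹ ∑_{first phase} z_i - (n(1-θ))⁻¹ ∑_{second phase} z_j`. -/
def psi (n k : ℕ) (z : ℕ → Fin p → ℝ) : Fin p → ℝ :=
  (1 / (n * theta n k)) • ∑ i ∈ range k, z i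
    - (1 / (n * (1 - theta n k))) • ∑ j ∈ Ico k n, z j

/-- The sample second-moment matrix
`S = (nθ²)⁻¹ ∑_{first phase} z_i z_iᵗ + (n(1-θ)²)⁻¹ ∑_{second phase} z_j z_jᵗ`. -/
def secondMoment (n k : ℕ) (z : ℕ → Fin p → ℝ) : Matrix (Fin p) (Fin p) ℝ :=
  (1 / (n * theta n k ^ 2)) • ∑ i ∈ range k, vecMulVec (z i) (z i)
    + (1 / (n * (1 - theta n k) ^ 2)) • ∑ j ∈ Ico k n, vecMulVec (z j) (z j)

/-- `lam` is a Lagrange multiplier of the empirical likelihood problem for the vectors `z`: the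
denominators of the score equation (that is, the weights `1 / (k + n lamᵗ z_i)` and
`1 / (n - k - n lamᵗ z_j)`, which are probabilities) are positive, and `lam` solves this
equation. -/
structure IsLagrangeMultiplier (n k : ℕ) (z : ℕ → Fin p → ℝ) (lam : Fin p → ℝ) : Prop where
  pos_first : ∀ i ∈ range k, 0 < theta n k + lam ⬝ᵥ z i
  pos_second : ∀ j ∈ Ico k n, 0 < 1 - theta n k - lam ⬝ᵥ z j
  score_eq : ∑ i ∈ range k, (1 / (theta n k + lam ⬝ᵥ z i)) • z i
    - ∑ j ∈ Ico k n, (1 / (1 - theta n k - lam ⬝ᵥ z j)) • z j = 0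

open scoped Classical in
/-- The Lagrange multiplier (with the value `0` when there is none). -/
def lagrangeMultiplier (n k : ℕ) (z : ℕ → Fin p → ℝ) : Fin p → ℝ :=
  if h : ∃ lam, IsLagrangeMultiplier n k z lam then h.choose else 0

/-- The empirical likelihood ratio statistic
`2 ∑ log (1 + (n/k) λᵗ z_i) + 2 ∑ log (1 - (n/(n-k)) λᵗ z_j)`, where `λ` is the Lagrange
multiplier. -/
def empLik (n k : ℕ) (z : ℕ → Fin p → ℝ) : ℝ :=
  2 * ∑ i ∈ range k, Real.log (1 + (n : ℝ) / k * (lagrangeMultiplier n k z ⬝ᵥ z i))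
    + 2 * ∑ j ∈ Ico k n,
        Real.log (1 - (n : ℝ) / ((n : ℝ) - k) * (lagrangeMultiplier n k z ⬝ᵥ z j))

/-- The mean `V` of `S` under the null hypothesis, for errors of variance `σ²`:
`V = (nθ²)⁻¹ ∑_{first phase} σ² X_i X_iᵗ + (n(1-θ)²)⁻¹ ∑_{second phase} σ² X_j X_jᵗ`. -/
def meanSecondMoment (n k : ℕ) (x : ℕ → Fin p → ℝ) (σ : ℝ) : Matrix (Fin p) (Fin p) ℝ :=
  (1 / (n * theta n k ^ 2)) • ∑ i ∈ range k, σ ^ 2 • vecMulVec (x i) (x i)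
    + (1 / (n * (1 - theta n k) ^ 2)) • ∑ j ∈ Ico k n, σ ^ 2 • vecMulVec (x j) (x j)

theorem meanSecondMoment_isHermitian (n k : ℕ) (x : ℕ → Fin p → ℝ) (σ : ℝ) :
    (meanSecondMoment n k x σ).IsHermitian := by
  ext a b
  simp [meanSecondMoment, Matrix.sum_apply, vecMulVec_apply, mul_comm]

/-- The inverse square root `A^{-1/2}` of a symmetric positive definite matrix. -/
def invSqrt (A : Matrix (Fin p) (Fin p) ℝ) : Matrix (Fin p) (Fin p) ℝ :=
  cfc (fun t : ℝ => (Real.sqrt t)⁻¹) A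

/-- The standardized vector `w_i = V^{-1/2} z_i`. -/
def whiten (n k : ℕ) (x : ℕ → Fin p → ℝ) (σ : ℝ) (z : ℕ → Fin p → ℝ) (i : ℕ) : Fin p → ℝ :=
  invSqrt (meanSecondMoment n k x σ) *ᵥ z i

/-- The averaged mixed moments
`α^{t₁ ⋯ t_r} = (nθ^r)⁻¹ ∑_{first phase} E[w_{i,t₁} ⋯ w_{i,t_r}]
  + (n(θ-1)^r)⁻¹ ∑_{second phase} E[w_{j,t₁} ⋯ w_{j,t_r}]`. -/
def alpha {Ω : Type*} [MeasurableSpace Ω] (μ : Measure Ω) (n k : ℕ) (x : ℕ → Fin p → ℝ) (σ : ℝ)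
    (z : Ω → ℕ → Fin p → ℝ) {r : ℕ} (t : Fin r → Fin p) : ℝ :=
  1 / (n * theta n k ^ r) * ∑ i ∈ range k, ∫ ω, ∏ a, whiten n k x σ (z ω) i (t a) ∂μ
    + 1 / (n * (theta n k - 1) ^ r) *
        ∑ j ∈ Ico k n, ∫ ω, ∏ a, whiten n k x σ (z ω) j (t a) ∂μ

end OneSample

/-- The linear model with one change-point: for the sample size `n`, the coefficient is `β n` on
the first phase and `β₂ n` on the second one; the design `X` is deterministic, and the errors are
i.i.d., centred, with finite variance `σ²`. The number `p n` of explanatory variables tends to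
infinity, and `k n / n` converges to a point of `(0, 1)`. -/
structure TwoPhaseModel {Ω : Type*} [MeasurableSpace Ω] (μ : Measure Ω) (p k : ℕ → ℕ)
    (X : (n : ℕ) → ℕ → Fin (p n) → ℝ) (β β₂ : (n : ℕ) → Fin (p n) → ℝ) (σ : ℝ)
    (ε : ℕ → Ω → ℝ) (Y : ℕ → ℕ → Ω → ℝ) : Prop where
  indep : iIndepFun ε μ
  ident : ∀ i, IdentDistrib (ε i) (ε 0) μ μ
  sq_integrable : MemLp (ε 0) 2 μ
  mean_zero : ∫ ω, ε 0 ω ∂μ = 0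
  variance_eq : variance (ε 0) μ = σ ^ 2
  first_phase : ∀ n, ∀ i ∈ range (k n), ∀ ω, Y n i ω = X n i ⬝ᵥ β n + ε i ω
  second_phase : ∀ n, ∀ i ∈ Ico (k n) n, ∀ ω, Y n i ω = X n i ⬝ᵥ β₂ n + ε i ω
  dim_tendsto : Tendsto p atTop atTop
  change_point : ∃ θ₀ ∈ Set.Ioo (0 : ℝ) 1, Tendsto (fun n => theta n (k n)) atTop (𝓝 θ₀)

/-- All eigenvalues of `V` lie between two positive constants, for large `n`. -/
def EigenvaluesBounded (p k : ℕ → ℕ) (X : (n : ℕ) → ℕ → Fin (p n) → ℝ) (σ : ℝ) : Prop :=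
  ∃ C₀ C₁ : ℝ, 0 < C₀ ∧ ∀ᶠ n in atTop, ∀ r : Fin (p n),
    C₀ < (meanSecondMoment_isHermitian n (k n) (X n) σ).eigenvalues r ∧
      (meanSecondMoment_isHermitian n (k n) (X n) σ).eigenvalues r < C₁

/-- `p⁻¹ ∑_s |X_{i,s}|^q` is bounded, uniformly in the observation and in large `n`. -/
def DesignBounded (p : ℕ → ℕ) (X : (n : ℕ) → ℕ → Fin (p n) → ℝ) (q : ℝ) : Prop :=
  ∃ C₃ : ℝ, 0 < C₃ ∧ ∀ᶠ n in atTop, ∀ i ∈ range n,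
    ((p n : ℝ))⁻¹ * ∑ s, |X n i s| ^ q < C₃

/-- `∑_{r,s} α^{rrss} = O(p²)`, where `α n` gives the mixed moments for the sample size `n`. -/
def FourthMomentCondition (p : ℕ → ℕ) (α : (n : ℕ) → {m : ℕ} → (Fin m → Fin (p n)) → ℝ) : Prop :=
  (fun n => ∑ r, ∑ s, α n ![r, r, s, s]) =O[atTop] fun n => (p n : ℝ) ^ 2

/-- `∑_{r,s,u} α^{rsu} α^{rsu} = O(p^{5/2})` and `∑_{r,s,u} α^{rss} α^{suu} = O(p^{5/2})`. -/
def ThirdMomentCondition (p : ℕ → ℕ) (α : (n : ℕ) → {m : ℕ} → (Fin m → Fin (p n)) → ℝ) : Prop :=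
  ((fun n => ∑ r, ∑ s, ∑ u, α n ![r, s, u] * α n ![r, s, u])
      =O[atTop] fun n => (p n : ℝ) ^ (5 / 2 : ℝ)) ∧
    (fun n => ∑ r, ∑ s, ∑ u, α n ![r, s, s] * α n ![s, u, u])
      =O[atTop] fun n => (p n : ℝ) ^ (5 / 2 : ℝ)

/-- `f n = o_P(a n)`. -/
def IsLittleOP {Ω : Type*} [MeasurableSpace Ω] (μ : Measure Ω) (f : ℕ → Ω → ℝ) (a : ℕ → ℝ) :
    Prop :=
  ∀ δ : ℝ, 0 < δ → Tendsto (fun n => μ {ω | δ * a n < |f n ω|}) atTop (𝓝 0)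

/-- The property `P n` holds with probability tending to one. -/
def WithProbTendingToOne {Ω : Type*} [MeasurableSpace Ω] (μ : Measure Ω) (P : ℕ → Ω → Prop) :
    Prop :=
  Tendsto (fun n => μ {ω | ¬ P n ω}) atTop (𝓝 0)

end TwoSampleEL

end

namespace TwoSampleEL

/-! The two phases merge into one sample: with signed weights `1 / θ` and `-1 / (1 - θ)` absorbed in
the design, `a i` is the weighted regressor and `u i = ε i • a i`. Then `ψ` is the mean of the `u
i`, `S` their second-moment matrix, and the score equation becomes `∑ u i / (1 + λ · u i) = 0`. So
the multiplier is a critical point of the concave function `F v = ∑ log (1 + v · u i)`, and the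
statistic is `2 F λ`.

Existence is deterministic (`exists_isOneSampleMultiplier`): on a ball where all `|v · u i| ≤ 1/2`,
`F` lies below a concave quadratic, and when `∑ u i` is small compared with the smallest eigenvalue
of `n S`, this forces the maximizer into the interior. Uniqueness is strict concavity.

The expansion needs no estimate of the distance from `λ` to `S⁻¹ ψ`. As `λ` maximizes `F` on the
ball, comparing `F λ` with `F x` for one explicit point `x` suffices (`abs_two_mul_sum_log_sub_le`).
The choice is the pilot `x = V⁻¹ ψ`: it is linear in the errors with deterministic coefficients, so
the moments of every remainder can be computed. With `y = S⁻¹ ψ`, the remainders are `∑ ((y - x) · u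
i)²`, governed by the residual `n (V - S) V⁻¹ ψ`, and `∑ (x · u i)⁴`. The residual is coordinatewise
a bilinear form in `ε i ^ 2 - σ²` and `ε j`, and a second-moment bound for such forms
(`IsIID.integral_bilin_sq_le`) controls it. The fourth-order sum is handled by fourth moments of
linear forms. A cubic term is traded for the quartic one at a free scale `τ`.

As the `a i` have squared norm `O(p)`, the quadratic and quartic remainders have mean `O(p² / n)`.
With `ρ = p / √n → 0` and `τ = ρ / √p`, the total error is `o(√p)` in probability. Markov's
inequality gives all the exceptional sets, including those where `S` is far from `V` or some `u i`
is too large. -/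

/-! ### Scalar inequalities for the logarithm. -/

/-- With `w = √(1 + r)`, the bound `2 log w ≤ 2 (w - 1)` leaves the gap `(w - 1)² (9 - (w + 1)²) /
9`, which is nonnegative exactly because `r ≤ 3` means `w ≤ 2`. -/
theorem log_one_add_le_sub_sq {r : ℝ} (h1 : -1 < r) (h2 : r ≤ 3) :
    Real.log (1 + r) ≤ r - r ^ 2 / 9 := by
  have hpos : 0 < 1 + r := by linarith
  set w := Real.sqrt (1 + r) with hw
  have hw0 : 0 < w := Real.sqrt_pos.2 hpos
  have hw2 : w ^ 2 = 1 + r := Real.sq_sqrt hpos.le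
  have hwle : w ≤ 2 := by nlinarith
  have hlog : Real.log (1 + r) = 2 * Real.log w := by
    rw [← hw2, Real.log_pow]; norm_num
  have hl := Real.log_le_sub_one_of_pos hw0
  have hr : r = w ^ 2 - 1 := by linarith
  rw [hlog, hr]
  have h9 : (w + 1) ^ 2 ≤ 9 := by nlinarith
  nlinarith [mul_nonneg (sq_nonneg (w - 1)) (sub_nonneg.2 h9)]

theorem abs_log_one_add_sub_le {t : ℝ} (ht : |t| ≤ 1 / 2) :
    |Real.log (1 + t) - (t - t ^ 2 / 2)| ≤ 2 * |t| ^ 3 := by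
  have h := Real.abs_log_sub_add_sum_range_le (x := -t) (by rw [abs_neg]; linarith) 2
  simp only [sum_range_succ, sum_range_zero, abs_neg, sub_neg_eq_add] at h
  have e : (0 + (-t) ^ (0 + 1) / ((0 : ℕ) + 1) + (-t) ^ (1 + 1) / ((1 : ℕ) + 1) : ℝ)
      + Real.log (1 + t) = Real.log (1 + t) - (t - t ^ 2 / 2) := by
    push_cast; ring
  rw [e] at h
  refine h.trans ?_
  rw [div_le_iff₀ (by linarith)]
  change |t| ^ 3 ≤ _
  nlinarith [mul_nonneg (pow_nonneg (abs_nonneg t) 3) (sub_nonneg.2 ht)]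

/-- The tangent of the logarithm at `s` has slope `1 / (1 + s)`, here replaced by `1 - s - d` with a
free perturbation `d`. The slope error is paid for by strict concavity, so the cost does not depend
on `t`. In the application `d` is chosen so that the linear terms cancel after summation. -/
theorem log_one_add_le_log_add {s t d : ℝ} (hs : |s| ≤ 1 / 2) (ht : |t| ≤ 1 / 2) :
    Real.log (1 + t) ≤
      Real.log (1 + s) + (t - s) * (1 - s - d) + (25 / 2 * d ^ 2 + 50 * s ^ 4) := by
  obtain ⟨hs1, hs2⟩ := abs_le.1 hs
  obtain ⟨ht1, ht2⟩ := abs_le.1 ht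
  have hs0 : 0 < 1 + s := by linarith
  have ht0 : 0 < 1 + t := by linarith
  set r := (t - s) / (1 + s) with hr
  have hts : (1 + t) = (1 + s) * (1 + r) := by rw [hr]; field_simp; ring
  have hr1 : -1 < r := by rw [hr, lt_div_iff₀ hs0]; linarith
  have hr2 : r ≤ 3 := by rw [hr, div_le_iff₀ hs0]; linarith
  have hlog : Real.log (1 + t) = Real.log (1 + s) + Real.log (1 + r) := by
    rw [hts, Real.log_mul hs0.ne' (by linarith)]
  have h1 := log_one_add_le_sub_sq hr1 hr2
  set e := s ^ 2 / (1 + s) with he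
  have hre : r = (t - s) * (1 - s) + (t - s) * e := by
    rw [hr, he]; field_simp; ring
  -- This negative quadratic absorbs `(t - s) * (d + e)`, leaving `25 / 4 * (d + e) ^ 2`; then `e ^
  -- 2 ≤ 4 * s ^ 4` produces the constants `25 / 2` and `50`.
  have hr3 : (t - s) ^ 2 / 25 ≤ r ^ 2 / 9 := by
    have : t - s = r * (1 + s) := by rw [hr]; field_simp
    rw [this]
    nlinarith [mul_nonneg (sq_nonneg r) (show (0 : ℝ) ≤ 9 / 4 - (1 + s) ^ 2 by nlinarith)]
  have he2 : e ^ 2 ≤ 4 * s ^ 4 := by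
    have he0 : 0 ≤ e := by positivity
    have he1 : e ≤ 2 * s ^ 2 := by
      rw [he, div_le_iff₀ hs0]; nlinarith [sq_nonneg s]
    calc e ^ 2 ≤ (2 * s ^ 2) ^ 2 := by gcongr
      _ = 4 * s ^ 4 := by ring
  nlinarith [sq_nonneg ((t - s) / 5 - 5 / 2 * (d + e)), sq_nonneg (d - e)]

/-- Replaces absolute third powers by fourth powers, whose moments are computable; the scale `τ` is
optimized only at the end. -/
theorem abs_pow_three_le {s τ : ℝ} (hτ : 0 < τ) : |s| ^ 3 ≤ τ ^ 3 + s ^ 4 / τ := by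
  have h0 := abs_nonneg s
  have e : s ^ 4 = |s| ^ 4 := by rw [← abs_pow, abs_of_nonneg (by positivity)]
  rw [e]
  rcases le_total |s| τ with h | h
  · have : |s| ^ 3 ≤ τ ^ 3 := by gcongr
    have : 0 ≤ |s| ^ 4 / τ := by positivity
    linarith
  · have : |s| ^ 3 ≤ |s| ^ 4 / τ := by
      rw [le_div_iff₀ hτ, pow_succ |s| 3]; gcongr
    have : 0 ≤ τ ^ 3 := by positivity
    linarith

/-! ### Deterministic theory of the one-sample multiplier. -/

section Multiplier

variable {ι : Type*} {p : ℕ}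

theorem dotProduct_sq_le (v w : Fin p → ℝ) : (v ⬝ᵥ w) ^ 2 ≤ (v ⬝ᵥ v) * (w ⬝ᵥ w) := by
  simpa [dotProduct, sq] using sum_mul_sq_le_sq_mul_sq univ v w

theorem dotProduct_self_nonneg' (v : Fin p → ℝ) : 0 ≤ v ⬝ᵥ v :=
  Finset.sum_nonneg fun i _ => mul_self_nonneg (v i)

theorem abs_dotProduct_le_half {v w : Fin p → ℝ} {M : ℝ} (hw : w ⬝ᵥ w ≤ M)
    (hv : 4 * M * (v ⬝ᵥ v) ≤ 1) : |v ⬝ᵥ w| ≤ 1 / 2 := by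
  apply abs_le_of_sq_le_sq _ (by norm_num)
  have := dotProduct_sq_le v w
  have := mul_le_mul_of_nonneg_left hw (dotProduct_self_nonneg' v)
  nlinarith

theorem isCompact_setOf_dotProduct_self_le (r : ℝ) :
    IsCompact {v : Fin p → ℝ | v ⬝ᵥ v ≤ r} := by
  apply Metric.isCompact_of_isClosed_isBounded
  · exact isClosed_le (by fun_prop) continuous_const
  · refine (Metric.isBounded_closedBall (x := (0 : Fin p → ℝ)) (r := Real.sqrt r)).subset ?_
    intro v hv
    rw [mem_closedBall_zero_iff, pi_norm_le_iff_of_nonneg (Real.sqrt_nonneg _)]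
    intro i
    rw [Real.norm_eq_abs]
    apply Real.abs_le_sqrt
    refine le_trans ?_ hv
    rw [sq]
    exact Finset.single_le_sum (f := fun i => v i * v i) (fun i _ => mul_self_nonneg (v i))
      (mem_univ i)

/-- `lam` is a Lagrange multiplier for the one-sample empirical likelihood problem of the
vectors `u i`, `i ∈ s`. -/
structure IsOneSampleMultiplier (s : Finset ι) (u : ι → Fin p → ℝ) (lam : Fin p → ℝ) : Prop where
  pos : ∀ i ∈ s, 0 < 1 + lam ⬝ᵥ u i
  score_eq : ∑ i ∈ s, (1 / (1 + lam ⬝ᵥ u i)) • u i = 0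

/-- Pairing the difference of the two score equations with `l₁ - l₂` gives a sum of squares with
positive weights that vanishes; the lower bound on the quadratic form then kills `l₁ - l₂`. -/
theorem IsOneSampleMultiplier.unique {s : Finset ι} {u : ι → Fin p → ℝ} {c : ℝ} (hc : 0 < c)
    (hB : ∀ v : Fin p → ℝ, c * (v ⬝ᵥ v) ≤ ∑ i ∈ s, (v ⬝ᵥ u i) ^ 2) {l₁ l₂ : Fin p → ℝ}
    (h₁ : IsOneSampleMultiplier s u l₁) (h₂ : IsOneSampleMultiplier s u l₂) : l₁ = l₂ := by
  have key : ∑ i ∈ s, ((l₁ - l₂) ⬝ᵥ u i) ^ 2 / ((1 + l₁ ⬝ᵥ u i) * (1 + l₂ ⬝ᵥ u i)) = 0 := by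
    have e₁ := congrArg (fun w => (l₁ - l₂) ⬝ᵥ w) h₁.score_eq
    have e₂ := congrArg (fun w => (l₁ - l₂) ⬝ᵥ w) h₂.score_eq
    simp only [dotProduct_sum, dotProduct_smul, dotProduct_zero, smul_eq_mul] at e₁ e₂
    rw [← sub_zero (0 : ℝ)]
    nth_rewrite 1 [← e₂]
    rw [← e₁, ← sum_sub_distrib]
    refine sum_congr rfl fun i hi => ?_
    have p₁ := (h₁.pos i hi).ne'
    have p₂ := (h₂.pos i hi).ne'
    rw [sub_dotProduct]
    field_simp
    ring
  have hz := (sum_eq_zero_iff_of_nonneg fun i hi =>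
    div_nonneg (sq_nonneg _) (mul_pos (h₁.pos i hi) (h₂.pos i hi)).le).1 key
  have h0 : ∑ i ∈ s, ((l₁ - l₂) ⬝ᵥ u i) ^ 2 = 0 := by
    refine sum_eq_zero fun i hi => ?_
    have := hz i hi
    rw [div_eq_zero_iff] at this
    exact this.resolve_right (mul_pos (h₁.pos i hi) (h₂.pos i hi)).ne'
  have h1 := hB (l₁ - l₂)
  rw [h0] at h1
  have h2 : (l₁ - l₂) ⬝ᵥ (l₁ - l₂) = 0 :=
    le_antisymm (by nlinarith) (dotProduct_self_nonneg' _)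
  exact sub_eq_zero.1 (dotProduct_self_eq_zero.1 h2)

theorem sum_log_one_add_le {s : Finset ι} {u : ι → Fin p → ℝ} {M : ℝ}
    (hu : ∀ i ∈ s, u i ⬝ᵥ u i ≤ M) {v : Fin p → ℝ} (hv : 4 * M * (v ⬝ᵥ v) ≤ 1) :
    ∑ i ∈ s, Real.log (1 + v ⬝ᵥ u i) ≤
      v ⬝ᵥ (∑ i ∈ s, u i) - (∑ i ∈ s, (v ⬝ᵥ u i) ^ 2) / 9 := by
  rw [dotProduct_sum, sum_div, ← sum_sub_distrib]
  refine sum_le_sum fun i hi => ?_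
  obtain ⟨h1, h2⟩ := abs_le.1 (abs_dotProduct_le_half (hu i hi) hv)
  exact log_one_add_le_sub_sq (by linarith) (by linarith)

/-- The multiplier is the maximizer of the log-sum over a compact ball. Since the log-sum is zero at
the origin, its quadratic upper bound forces `c / 9 * |lam|² ≤ lam · g`, hence `|lam| ≤ 9 |g| / c`.
The constant `324 = 4 * 81` makes this strictly interior, so all directional derivatives vanish
there. Maximality is part of the conclusion because the expansion relies on it. -/
theorem exists_isOneSampleMultiplier {s : Finset ι} {u : ι → Fin p → ℝ} {c M : ℝ} (hc : 0 < c)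
    (hM : 0 < M) (hu : ∀ i ∈ s, u i ⬝ᵥ u i ≤ M)
    (hB : ∀ v : Fin p → ℝ, c * (v ⬝ᵥ v) ≤ ∑ i ∈ s, (v ⬝ᵥ u i) ^ 2)
    (hg : 324 * M * ((∑ i ∈ s, u i) ⬝ᵥ (∑ i ∈ s, u i)) < c ^ 2) :
    ∃ lam, IsOneSampleMultiplier s u lam ∧ 4 * M * (lam ⬝ᵥ lam) ≤ 1 ∧
      ∀ v : Fin p → ℝ, 4 * M * (v ⬝ᵥ v) ≤ 1 →
        ∑ i ∈ s, Real.log (1 + v ⬝ᵥ u i) ≤ ∑ i ∈ s, Real.log (1 + lam ⬝ᵥ u i) := by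
  set F : (Fin p → ℝ) → ℝ := fun v => ∑ i ∈ s, Real.log (1 + v ⬝ᵥ u i) with hF
  set g := ∑ i ∈ s, u i with hgdef
  set D : Set (Fin p → ℝ) := {v | v ⬝ᵥ v ≤ 1 / (4 * M)} with hD
  have hDiff : ∀ v, v ∈ D ↔ 4 * M * (v ⬝ᵥ v) ≤ 1 := by
    intro v
    rw [hD, Set.mem_ofPred_eq, le_div_iff₀ (by positivity), mul_comm]
  have hhalf : ∀ v ∈ D, ∀ i ∈ s, 0 < 1 + v ⬝ᵥ u i := by
    intro v hv i hi
    have := (abs_le.1 (abs_dotProduct_le_half (hu i hi) ((hDiff v).1 hv))).1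
    linarith
  have hcont : ContinuousOn F D := by
    apply continuousOn_finsetSum
    intro i hi
    apply ContinuousOn.log
    · fun_prop
    · intro v hv
      exact (hhalf v hv i hi).ne'
  have h0D : (0 : Fin p → ℝ) ∈ D := by
    rw [hDiff]; simp
  obtain ⟨lam, hlam, hmax⟩ :=
    (isCompact_setOf_dotProduct_self_le (p := p) (1 / (4 * M))).exists_isMaxOn ⟨0, h0D⟩ hcont
  have hlamlt : 4 * M * (lam ⬝ᵥ lam) < 1 := by
    have h1 : F 0 ≤ F lam := hmax h0D
    have h2 := sum_log_one_add_le hu ((hDiff lam).1 hlam)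
    have h3 := hB lam
    have h4 : F 0 = 0 := by simp [hF]
    have h5 : c / 9 * (lam ⬝ᵥ lam) ≤ lam ⬝ᵥ g := by
      simp only [hF] at h1 h4
      linarith
    have h6 := dotProduct_sq_le lam g
    have hL := dotProduct_self_nonneg' lam
    rcases hL.eq_or_lt with hL0 | hL0
    · rw [← hL0]; norm_num
    · have h7 : (c / 9 * (lam ⬝ᵥ lam)) ^ 2 ≤ (lam ⬝ᵥ lam) * (g ⬝ᵥ g) :=
        le_trans (pow_le_pow_left₀ (by positivity) h5 2) h6
      have h8 : c ^ 2 * (lam ⬝ᵥ lam) ≤ 81 * (g ⬝ᵥ g) := by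
        have : (lam ⬝ᵥ lam) * (c ^ 2 * (lam ⬝ᵥ lam)) ≤ (lam ⬝ᵥ lam) * (81 * (g ⬝ᵥ g)) := by
          nlinarith
        exact le_of_mul_le_mul_left this hL0
      have h9 : c ^ 2 * (4 * M * (lam ⬝ᵥ lam)) < c ^ 2 * 1 := by nlinarith
      exact lt_of_mul_lt_mul_left h9 (by positivity)
  refine ⟨lam, ⟨hhalf lam hlam, ?_⟩, hlamlt.le, fun v hv => hmax ((hDiff v).2 hv)⟩
  have hdir : ∀ w : Fin p → ℝ, ∑ i ∈ s, (w ⬝ᵥ u i) / (1 + lam ⬝ᵥ u i) = 0 := by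
    intro w
    have hder : HasDerivAt (fun t : ℝ => ∑ i ∈ s, Real.log (1 + (lam + t • w) ⬝ᵥ u i))
        (∑ i ∈ s, (w ⬝ᵥ u i) / (1 + lam ⬝ᵥ u i)) 0 := by
      apply HasDerivAt.fun_sum
      intro i hi
      have h1 : HasDerivAt (fun t : ℝ => 1 + (lam + t • w) ⬝ᵥ u i) (w ⬝ᵥ u i) 0 := by
        have : (fun t : ℝ => 1 + (lam + t • w) ⬝ᵥ u i)
            = fun t : ℝ => (1 + lam ⬝ᵥ u i) + t * (w ⬝ᵥ u i) := by
          funext t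
          rw [add_dotProduct, smul_dotProduct, smul_eq_mul]; ring
        rw [this]
        simpa using ((hasDerivAt_id (0 : ℝ)).mul_const (w ⬝ᵥ u i)).const_add (1 + lam ⬝ᵥ u i)
      have h2 := h1.log (by simpa using (hhalf lam hlam i hi).ne')
      simpa using h2
    have hloc : IsLocalMax (fun t : ℝ => ∑ i ∈ s, Real.log (1 + (lam + t • w) ⬝ᵥ u i)) 0 := by
      have hc' : Continuous fun t : ℝ => 4 * M * ((lam + t • w) ⬝ᵥ (lam + t • w)) := by
        fun_prop
      have hev : ∀ᶠ t in 𝓝 (0 : ℝ), 4 * M * ((lam + t • w) ⬝ᵥ (lam + t • w)) < 1 :=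
        hc'.continuousAt.eventually_lt continuousAt_const (by simpa using hlamlt)
      filter_upwards [hev] with t ht
      have := hmax ((hDiff _).2 ht.le)
      simpa [hF] using this
    exact hloc.hasDerivAt_eq_zero hder
  ext j
  have := hdir (Pi.single j 1)
  simp only [single_dotProduct, one_mul] at this
  simpa [Finset.sum_apply, div_eq_inv_mul] using this

/-- The statistic is compared with the quadratic form at an arbitrary point `x` close to its
maximizer `y`. -/
theorem abs_two_mul_sum_log_sub_le {s : Finset ι} {u : ι → Fin p → ℝ} {M τ : ℝ}
    (hτ : 0 < τ) (hu : ∀ i ∈ s, u i ⬝ᵥ u i ≤ M) {lam x y : Fin p → ℝ}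
    (hlam : 4 * M * (lam ⬝ᵥ lam) ≤ 1)
    (hmax : ∀ v : Fin p → ℝ, 4 * M * (v ⬝ᵥ v) ≤ 1 →
        ∑ i ∈ s, Real.log (1 + v ⬝ᵥ u i) ≤ ∑ i ∈ s, Real.log (1 + lam ⬝ᵥ u i))
    (hx : 4 * M * (x ⬝ᵥ x) ≤ 1)
    (hy : ∀ v : Fin p → ℝ, ∑ i ∈ s, (y ⬝ᵥ u i) * (v ⬝ᵥ u i) = v ⬝ᵥ ∑ i ∈ s, u i) :
    |2 * ∑ i ∈ s, Real.log (1 + lam ⬝ᵥ u i) - y ⬝ᵥ ∑ i ∈ s, u i| ≤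
      26 * ∑ i ∈ s, ((y - x) ⬝ᵥ u i) ^ 2 + (100 + 4 / τ) * ∑ i ∈ s, (x ⬝ᵥ u i) ^ 4
        + 4 * (s.card * τ ^ 3) := by
  have hT3 : ∑ i ∈ s, |x ⬝ᵥ u i| ^ 3 ≤ s.card * τ ^ 3 + (∑ i ∈ s, (x ⬝ᵥ u i) ^ 4) / τ := by
    calc ∑ i ∈ s, |x ⬝ᵥ u i| ^ 3 ≤ ∑ i ∈ s, (τ ^ 3 + (x ⬝ᵥ u i) ^ 4 / τ) :=
          sum_le_sum fun i _ => abs_pow_three_le hτ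
      _ = _ := by rw [sum_add_distrib, sum_const, nsmul_eq_mul, sum_div]
  have hFx : |2 * ∑ i ∈ s, Real.log (1 + x ⬝ᵥ u i)
      - (2 * (x ⬝ᵥ ∑ i ∈ s, u i) - ∑ i ∈ s, (x ⬝ᵥ u i) ^ 2)| ≤ 4 * ∑ i ∈ s, |x ⬝ᵥ u i| ^ 3 := by
    have : 2 * ∑ i ∈ s, Real.log (1 + x ⬝ᵥ u i)
      - (2 * (x ⬝ᵥ ∑ i ∈ s, u i) - ∑ i ∈ s, (x ⬝ᵥ u i) ^ 2)
      = ∑ i ∈ s, 2 * (Real.log (1 + x ⬝ᵥ u i) - (x ⬝ᵥ u i - (x ⬝ᵥ u i) ^ 2 / 2)) := by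
      rw [← mul_sum, sum_sub_distrib, sum_sub_distrib, ← sum_div, dotProduct_sum]; ring
    rw [this, mul_sum]
    refine (abs_sum_le_sum_abs _ _).trans (sum_le_sum fun i hi => ?_)
    rw [abs_mul, abs_two]
    have := abs_log_one_add_sub_le (abs_dotProduct_le_half (hu i hi) hx)
    linarith
  -- Completing the square at `y`, the maximizer of the quadratic approximation.
  have hquad : 2 * (x ⬝ᵥ ∑ i ∈ s, u i) - ∑ i ∈ s, (x ⬝ᵥ u i) ^ 2
      = y ⬝ᵥ ∑ i ∈ s, u i - ∑ i ∈ s, ((y - x) ⬝ᵥ u i) ^ 2 := by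
    rw [← hy x, ← hy y, mul_sum, ← sum_sub_distrib, ← sum_sub_distrib]
    refine sum_congr rfl fun i _ => ?_
    rw [sub_dotProduct]; ring
  have hup : ∑ i ∈ s, Real.log (1 + lam ⬝ᵥ u i) ≤ ∑ i ∈ s, Real.log (1 + x ⬝ᵥ u i)
      + (25 / 2 * ∑ i ∈ s, ((y - x) ⬝ᵥ u i) ^ 2 + 50 * ∑ i ∈ s, (x ⬝ᵥ u i) ^ 4) := by
    -- With `d = (y - x) · u i` the slope is `1 - y · u i`, and the normal equation for `y`
    -- annihilates its pairing with any direction. This is why no bound on `lam - x` is needed.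
    have hzero : ∑ i ∈ s, (lam ⬝ᵥ u i - x ⬝ᵥ u i) * (1 - x ⬝ᵥ u i - (y - x) ⬝ᵥ u i) = 0 := by
      have := hy (lam - x)
      rw [dotProduct_sum, ← sub_eq_zero, ← sum_sub_distrib] at this
      rw [← neg_eq_zero, ← this, ← sum_neg_distrib]
      refine sum_congr rfl fun i _ => ?_
      rw [sub_dotProduct, sub_dotProduct]; ring
    have := sum_le_sum fun i hi => log_one_add_le_log_add (d := (y - x) ⬝ᵥ u i)
      (abs_dotProduct_le_half (hu i hi) hx) (abs_dotProduct_le_half (hu i hi) hlam)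
    rw [sum_add_distrib, sum_add_distrib, sum_add_distrib, hzero, ← mul_sum, ← mul_sum] at this
    linarith
  -- The reverse inequality is maximality of `lam` tested at `x`.
  have hlow := hmax x hx
  have hB0 : 0 ≤ ∑ i ∈ s, ((y - x) ⬝ᵥ u i) ^ 2 := sum_nonneg fun i _ => sq_nonneg _
  have h40 : 0 ≤ ∑ i ∈ s, (x ⬝ᵥ u i) ^ 4 := sum_nonneg fun i _ => by positivity
  have e : (100 + 4 / τ) * ∑ i ∈ s, (x ⬝ᵥ u i) ^ 4
      = 100 * ∑ i ∈ s, (x ⬝ᵥ u i) ^ 4 + 4 * ((∑ i ∈ s, (x ⬝ᵥ u i) ^ 4) / τ) := by ring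
  rw [e]
  rw [hquad] at hFx
  obtain ⟨hF1, hF2⟩ := abs_le.1 hFx
  rw [abs_le]
  constructor <;> linarith

/-- If the quadratic form of the `u i` has the lower bound `c`, then its value at `v` is controlled
by the image of `v` under the corresponding linear map. -/
theorem sum_dotProduct_sq_le {s : Finset ι} {u : ι → Fin p → ℝ} {c : ℝ} (hc : 0 < c)
    (hB : ∀ v : Fin p → ℝ, c * (v ⬝ᵥ v) ≤ ∑ i ∈ s, (v ⬝ᵥ u i) ^ 2) {v h : Fin p → ℝ}
    (hv : ∑ i ∈ s, (v ⬝ᵥ u i) • u i = h) :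
    ∑ i ∈ s, (v ⬝ᵥ u i) ^ 2 ≤ (h ⬝ᵥ h) / c := by
  have h1 : ∑ i ∈ s, (v ⬝ᵥ u i) ^ 2 = v ⬝ᵥ h := by
    rw [← hv, dotProduct_sum]
    refine sum_congr rfl fun i _ => ?_
    rw [dotProduct_smul, smul_eq_mul, sq]
  have h2 := dotProduct_sq_le v h
  have h3 := hB v
  rw [h1] at h3 ⊢
  have hv0 := dotProduct_self_nonneg' v
  have hh0 := dotProduct_self_nonneg' h
  have hvh : 0 ≤ v ⬝ᵥ h := le_trans (by positivity) h3
  rw [le_div_iff₀ hc]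
  rcases hvh.eq_or_lt with h0 | h0
  · rw [← h0]; simpa using hh0
  · have : (v ⬝ᵥ h) * (v ⬝ᵥ h * c) ≤ (v ⬝ᵥ h) * (h ⬝ᵥ h) := by
      calc (v ⬝ᵥ h) * (v ⬝ᵥ h * c) = c * (v ⬝ᵥ h) ^ 2 := by ring
        _ ≤ c * ((v ⬝ᵥ v) * (h ⬝ᵥ h)) := by gcongr
        _ = (c * (v ⬝ᵥ v)) * (h ⬝ᵥ h) := by ring
        _ ≤ _ := by gcongr
    exact le_of_mul_le_mul_left this h0

end Multiplier

/-! ### Moments of linear and bilinear forms in i.i.d. variables. -/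

section Moments

variable {Ω : Type*}

/-- The σ-algebra generated by the `ε j`, `j ∈ s`. -/
abbrev sigmaOf (ε : ℕ → Ω → ℝ) (s : Finset ℕ) : MeasurableSpace Ω :=
  MeasurableSpace.comap (fun ω (j : s) => ε j ω) inferInstance

theorem measurable_sigmaOf (ε : ℕ → Ω → ℝ) {s : Finset ℕ} {j : ℕ} (hj : j ∈ s) :
    Measurable[sigmaOf ε s] (ε j) := by
  have h : Measurable[sigmaOf ε s] (fun ω (j : s) => ε j ω) := comap_measurable _
  exact (measurable_pi_apply (⟨j, hj⟩ : s)).comp h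

/-- A weighted sum of the `f (ε j)`, `j ∈ s`. -/
abbrev linForm (ε : ℕ → Ω → ℝ) (f : ℝ → ℝ) (s : Finset ℕ) (c : ℕ → ℝ) (ω : Ω) : ℝ :=
  ∑ j ∈ s, c j * f (ε j ω)

theorem measurable_linForm (ε : ℕ → Ω → ℝ) {f : ℝ → ℝ} (hf : Measurable f) (s : Finset ℕ)
    (c : ℕ → ℝ) : Measurable[sigmaOf ε s] (linForm ε f s c) :=
  Finset.measurable_fun_sum _ fun _ hj => (hf.comp (measurable_sigmaOf ε hj)).const_mul _

variable [MeasurableSpace Ω] {μ : Measure Ω}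

/-- `ε` is an i.i.d. sequence of real random variables. -/
structure IsIID (μ : Measure Ω) (ε : ℕ → Ω → ℝ) : Prop where
  indep : iIndepFun ε μ
  ident : ∀ i, IdentDistrib (ε i) (ε 0) μ μ

variable {ε : ℕ → Ω → ℝ}

theorem IsIID.aemeasurable (h : IsIID μ ε) (i : ℕ) : AEMeasurable (ε i) μ :=
  (h.ident i).aemeasurable_fst

theorem IsIID.integral_comp (h : IsIID μ ε) {f : ℝ → ℝ} (hf : Measurable f) (i : ℕ) :
    ∫ ω, f (ε i ω) ∂μ = ∫ ω, f (ε 0 ω) ∂μ :=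
  ((h.ident i).comp hf).integral_eq

theorem IsIID.memLp_comp (h : IsIID μ ε) {f : ℝ → ℝ} (hf : Measurable f) {r : ℝ≥0∞}
    (h0 : MemLp (fun ω => f (ε 0 ω)) r μ) (i : ℕ) : MemLp (fun ω => f (ε i ω)) r μ :=
  ((h.ident i).comp hf).memLp_iff.2 h0

/-- The engine of the moment computations below: they add one index at a time, and whatever was
built from the earlier errors is independent of the new one. -/
theorem IsIID.indepFun (h : IsIID μ ε) {s : Finset ℕ} {m : ℕ} (hm : m ∉ s) {F : Ω → ℝ}
    (hF : Measurable[sigmaOf ε s] F) {f : ℝ → ℝ} (hf : Measurable f) :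
    IndepFun F (fun ω => f (ε m ω)) μ := by
  have h1 := h.indep.indepFun_finset₀ s {m} (by simpa using hm) h.aemeasurable
  rw [IndepFun_iff_Indep] at h1 ⊢
  refine indep_of_indep_of_le_left (indep_of_indep_of_le_right h1 ?_) hF.comap_le
  exact (hf.comp (measurable_sigmaOf ε (mem_singleton_self m))).comap_le

theorem IsIID.integral_mul_comp (h : IsIID μ ε) {s : Finset ℕ} {m : ℕ} (hm : m ∉ s) {F : Ω → ℝ}
    (hF : Measurable[sigmaOf ε s] F) (hF' : AEStronglyMeasurable F μ) {f : ℝ → ℝ}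
    (hf : Measurable f) :
    ∫ ω, F ω * f (ε m ω) ∂μ = (∫ ω, F ω ∂μ) * ∫ ω, f (ε 0 ω) ∂μ := by
  rw [(h.indepFun hm hF hf).integral_fun_mul_eq_mul_integral hF'
    (hf.comp_aemeasurable (h.aemeasurable m)).aestronglyMeasurable, h.integral_comp hf]

theorem IsIID.integrable_mul_comp (h : IsIID μ ε) {s : Finset ℕ} {m : ℕ} (hm : m ∉ s) {F : Ω → ℝ}
    (hF : Measurable[sigmaOf ε s] F) (hF' : Integrable F μ) {f : ℝ → ℝ}
    (hf : Measurable f) (hf' : Integrable (fun ω => f (ε m ω)) μ) :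
    Integrable (fun ω => F ω * f (ε m ω)) μ :=
  (h.indepFun hm hF hf).integrable_mul hF' hf'

theorem integral_add_three {f g h : Ω → ℝ} (hf : Integrable f μ) (hg : Integrable g μ)
    (hh : Integrable h μ) :
    ∫ ω, (f ω + g ω + h ω) ∂μ = ∫ ω, f ω ∂μ + ∫ ω, g ω ∂μ + ∫ ω, h ω ∂μ := by
  rw [← integral_add hf hg]
  exact integral_add (hf.add hg) hh

theorem integral_add_five {f g h k l : Ω → ℝ} (hf : Integrable f μ) (hg : Integrable g μ)
    (hh : Integrable h μ) (hk : Integrable k μ) (hl : Integrable l μ) :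
    ∫ ω, (f ω + g ω + h ω + k ω + l ω) ∂μ
      = ∫ ω, f ω ∂μ + ∫ ω, g ω ∂μ + ∫ ω, h ω ∂μ + ∫ ω, k ω ∂μ + ∫ ω, l ω ∂μ := by
  rw [← integral_add_three hf hg hh]
  exact integral_add_three ((hf.add hg).add hh) hk hl

theorem memLp_mul_four {f g : Ω → ℝ} (hf : MemLp f 4 μ) (hg : MemLp g 4 μ) :
    MemLp (fun ω => f ω * g ω) 2 μ := by
  have : ENNReal.HolderTriple 4 4 2 := ⟨by
    rw [← two_mul, show (4 : ℝ≥0∞) = 2 * 2 by norm_num,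
      ENNReal.mul_inv (Or.inl (by norm_num)) (Or.inl (by norm_num)), ← mul_assoc,
      ENNReal.mul_inv_cancel (by norm_num) (by norm_num), one_mul]⟩
  exact hg.mul' hf

theorem IsIID.memLp_linForm (h : IsIID μ ε) {f : ℝ → ℝ} (hf : Measurable f) {r : ℝ≥0∞}
    (h0 : MemLp (fun ω => f (ε 0 ω)) r μ) (s : Finset ℕ) (c : ℕ → ℝ) :
    MemLp (linForm ε f s c) r μ :=
  memLp_finsetSum _ fun j _ => (h.memLp_comp hf h0 j).const_mul _

variable [IsProbabilityMeasure μ]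

theorem integrable_pow_of_memLp {f : Ω → ℝ} {n : ℕ} (hf : MemLp f n μ) {m : ℕ} (hm : m ≤ n) :
    Integrable (fun ω => f ω ^ m) μ := by
  have h1 : MemLp f m μ := hf.mono_exponent (by exact_mod_cast hm)
  have h2 := h1.integrable_norm_pow'
  refine h2.mono' (hf.1.pow m) (Eventually.of_forall fun ω => ?_)
  rw [norm_pow]

theorem sq_integral_le_integral_pow_four {f : Ω → ℝ} (hf : MemLp f 4 μ) :
    (∫ ω, f ω ^ 2 ∂μ) ^ 2 ≤ ∫ ω, f ω ^ 4 ∂μ := by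
  have i4 : Integrable (fun ω => f ω ^ 4) μ := integrable_pow_of_memLp (n := 4) hf le_rfl
  have i2 : Integrable (fun ω => f ω ^ 2) μ := integrable_pow_of_memLp (n := 4) hf (by norm_num)
  set m := ∫ ω, f ω ^ 2 ∂μ with hm
  have h0 : 0 ≤ ∫ ω, (f ω ^ 2 - m) ^ 2 ∂μ := integral_nonneg fun ω => sq_nonneg _
  have e : ∫ ω, (f ω ^ 2 - m) ^ 2 ∂μ = ∫ ω, f ω ^ 4 ∂μ - m ^ 2 := by
    have : ∀ ω, (f ω ^ 2 - m) ^ 2 = f ω ^ 4 + (-2 * m) * f ω ^ 2 + m ^ 2 := fun ω => by ring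
    simp_rw [this]
    rw [integral_add_three i4 (i2.const_mul _) (integrable_const _), integral_const_mul, ← hm]
    simp; ring
  linarith

theorem IsIID.integral_linForm (h : IsIID μ ε) {f : ℝ → ℝ} (hf : Measurable f)
    (h0 : MemLp (fun ω => f (ε 0 ω)) 2 μ) (hz : ∫ ω, f (ε 0 ω) ∂μ = 0) (s : Finset ℕ)
    (c : ℕ → ℝ) : ∫ ω, linForm ε f s c ω ∂μ = 0 := by
  rw [integral_finsetSum _ fun j _ =>
    ((h.memLp_comp hf h0 j).integrable (by norm_num)).const_mul _]
  refine sum_eq_zero fun j _ => ?_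
  rw [integral_const_mul, h.integral_comp hf, hz, mul_zero]

theorem IsIID.integral_linForm_sq (h : IsIID μ ε) {f : ℝ → ℝ} (hf : Measurable f)
    (h0 : MemLp (fun ω => f (ε 0 ω)) 2 μ) (hz : ∫ ω, f (ε 0 ω) ∂μ = 0) (s : Finset ℕ)
    (c : ℕ → ℝ) :
    ∫ ω, linForm ε f s c ω ^ 2 ∂μ = (∫ ω, f (ε 0 ω) ^ 2 ∂μ) * ∑ j ∈ s, c j ^ 2 := by
  induction s using Finset.induction_on with
  | empty => simp [linForm]
  | insert m s hm ih =>
    have hS := h.memLp_linForm hf h0 s c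
    have hfm := h.memLp_comp hf h0 m
    have e : ∀ ω, linForm ε f (insert m s) c ω ^ 2 = linForm ε f s c ω ^ 2
        + 2 * c m * (linForm ε f s c ω * f (ε m ω)) + c m ^ 2 * f (ε m ω) ^ 2 := by
      intro ω
      simp only [linForm]
      rw [sum_insert hm]; ring
    simp_rw [e]
    have hmeas := measurable_linForm ε hf s c
    have iSX := h.integrable_mul_comp hm hmeas (hS.integrable (by norm_num)) hf
      (hfm.integrable (by norm_num))
    rw [integral_add_three hS.integrable_sq (iSX.const_mul _) (hfm.integrable_sq.const_mul _),
      integral_const_mul, integral_const_mul,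
      h.integral_mul_comp hm hmeas hS.1 hf, hz, ih, sum_insert hm,
      h.integral_comp (hf.pow_const 2) m]
    ring

/-- On adding an index, the terms of degree one or three in the new variable integrate to zero,
because the new variable and the old form are centred. The mixed even term involves `m2 ^ 2 ≤ m4`,
and the factor `3` closes the induction through `(A + c²)² = A² + 2 A c² + c⁴`. -/
theorem IsIID.integral_linForm_pow_four_le (h : IsIID μ ε) {f : ℝ → ℝ} (hf : Measurable f)
    (h0 : MemLp (fun ω => f (ε 0 ω)) 4 μ) (hz : ∫ ω, f (ε 0 ω) ∂μ = 0) (s : Finset ℕ)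
    (c : ℕ → ℝ) :
    ∫ ω, linForm ε f s c ω ^ 4 ∂μ ≤ 3 * (∫ ω, f (ε 0 ω) ^ 4 ∂μ) * (∑ j ∈ s, c j ^ 2) ^ 2 := by
  have h02 : MemLp (fun ω => f (ε 0 ω)) 2 μ := h0.mono_exponent (by norm_num)
  induction s using Finset.induction_on with
  | empty => simp [linForm]
  | insert m s hm ih =>
    have hS : MemLp (linForm ε f s c) ((4 : ℕ) : ℝ≥0∞) μ := h.memLp_linForm hf h0 s c
    have hfm : MemLp (fun ω => f (ε m ω)) ((4 : ℕ) : ℝ≥0∞) μ := h.memLp_comp hf h0 m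
    have e : ∀ ω, linForm ε f (insert m s) c ω ^ 4 = linForm ε f s c ω ^ 4
        + 4 * c m * (linForm ε f s c ω ^ 3 * f (ε m ω))
        + 6 * c m ^ 2 * (linForm ε f s c ω ^ 2 * f (ε m ω) ^ 2)
        + 4 * c m ^ 3 * (linForm ε f s c ω * f (ε m ω) ^ 3)
        + c m ^ 4 * f (ε m ω) ^ 4 := by
      intro ω
      simp only [linForm]
      rw [sum_insert hm]; ring
    simp_rw [e]
    have hmeas := measurable_linForm ε hf s c
    have iS : ∀ {r : ℕ}, r ≤ 4 → Integrable (fun ω => linForm ε f s c ω ^ r) μ :=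
      fun hr => integrable_pow_of_memLp hS hr
    have iX : ∀ {r : ℕ}, r ≤ 4 → Integrable (fun ω => f (ε m ω) ^ r) μ :=
      fun hr => integrable_pow_of_memLp hfm hr
    have iS1 : Integrable (linForm ε f s c) μ := by simpa using iS (r := 1) (by norm_num)
    have iX1 : Integrable (fun ω => f (ε m ω)) μ := by simpa using iX (r := 1) (by norm_num)
    have i31 := h.integrable_mul_comp hm (hmeas.pow_const 3) (iS (r := 3) (by norm_num)) hf iX1
    have i22 := h.integrable_mul_comp hm (hmeas.pow_const 2) (iS (r := 2) (by norm_num))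
      (hf.pow_const 2) (iX (r := 2) (by norm_num))
    have i13 := h.integrable_mul_comp hm hmeas iS1 (hf.pow_const 3) (iX (r := 3) (by norm_num))
    have j31 := (i31.const_mul (4 * c m))
    have j22 := (i22.const_mul (6 * c m ^ 2))
    have j13 := (i13.const_mul (4 * c m ^ 3))
    have j04 := (iX (r := 4) le_rfl).const_mul (c m ^ 4)
    have j40 := iS (r := 4) le_rfl
    rw [integral_add_five j40 j31 j22 j13 j04, integral_const_mul, integral_const_mul, integral_const_mul,
      integral_const_mul,
      h.integral_mul_comp hm (hmeas.pow_const 3) (hS.1.pow 3) hf,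
      h.integral_mul_comp hm (hmeas.pow_const 2) (hS.1.pow 2) (hf.pow_const 2),
      h.integral_mul_comp hm hmeas hS.1 (hf.pow_const 3), hz,
      h.integral_linForm hf h02 hz, h.integral_linForm_sq hf h02 hz,
      h.integral_comp (hf.pow_const 4) m, sum_insert hm]
    have hJ := sq_integral_le_integral_pow_four h0
    set A := ∑ j ∈ s, c j ^ 2
    set m2 := ∫ ω, f (ε 0 ω) ^ 2 ∂μ
    set m4 := ∫ ω, f (ε 0 ω) ^ 4 ∂μ
    have hA : 0 ≤ A := sum_nonneg fun j _ => sq_nonneg _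
    have h4 : 0 ≤ m4 := le_trans (sq_nonneg _) hJ
    have h5 : 0 ≤ 6 * (c m ^ 2 * A) * (m4 - m2 ^ 2) :=
      mul_nonneg (by positivity) (by linarith)
    have h6 : 0 ≤ 2 * m4 * (c m ^ 2) ^ 2 := by positivity
    nlinarith

/-- The fourth moment of the product of `ε i` and a weighted sum of all `ε j`, the term `j = i`
included. -/
theorem IsIID.integral_mul_linForm_pow_four_le (h : IsIID μ ε) (h8 : MemLp (ε 0) 8 μ)
    (hz : ∫ ω, ε 0 ω ∂μ = 0) {s : Finset ℕ} {i : ℕ} (hi : i ∈ s) (c : ℕ → ℝ) :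
    Integrable (fun ω => (ε i ω * ∑ j ∈ s, c j * ε j ω) ^ 4) μ ∧
    ∫ ω, (ε i ω * ∑ j ∈ s, c j * ε j ω) ^ 4 ∂μ ≤
      8 * (∫ ω, ε 0 ω ^ 8 ∂μ + 3 * (∫ ω, ε 0 ω ^ 4 ∂μ) ^ 2) * (∑ j ∈ s, c j ^ 2) ^ 2 := by
  have hid : Measurable (fun x : ℝ => x) := measurable_id
  have h4 : MemLp (ε 0) 4 μ := h8.mono_exponent (by norm_num)
  have h8i : MemLp (ε i) ((8 : ℕ) : ℝ≥0∞) μ := h.memLp_comp hid h8 i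
  set t := s.erase i with ht
  have hit : i ∉ t := notMem_erase i s
  have hL : MemLp (linForm ε (fun x => x) t c) ((4 : ℕ) : ℝ≥0∞) μ := h.memLp_linForm hid h4 t c
  have hLm := measurable_linForm ε hid t c
  have i8 : Integrable (fun ω => ε i ω ^ 8) μ := integrable_pow_of_memLp h8i le_rfl
  have i4 : Integrable (fun ω => ε i ω ^ 4) μ := integrable_pow_of_memLp h8i (by norm_num)
  have iL := integrable_pow_of_memLp hL le_rfl
  have iLX := h.integrable_mul_comp hit (hLm.pow_const 4) iL (hid.pow_const 4) i4
  -- The form without index `i` is independent of `ε i`; the remaining term contributes `c i * ε i ω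
  -- ^ 2`, whose fourth power is what requires the eighth moment.
  have hsplit : ∀ ω, ∑ j ∈ s, c j * ε j ω = c i * ε i ω + linForm ε (fun x => x) t c ω := by
    intro ω
    rw [← add_sum_erase s _ hi]
  have hbd : ∀ ω, (ε i ω * ∑ j ∈ s, c j * ε j ω) ^ 4 ≤
      8 * c i ^ 4 * ε i ω ^ 8 + 8 * (linForm ε (fun x => x) t c ω ^ 4 * ε i ω ^ 4) := by
    intro ω
    rw [hsplit]
    have : ∀ a b : ℝ, (a + b) ^ 4 ≤ 8 * a ^ 4 + 8 * b ^ 4 := by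
      intro a b
      nlinarith [sq_nonneg (a ^ 2 - b ^ 2), sq_nonneg (a - b), sq_nonneg ((a - b) * (a + b)),
        sq_nonneg ((a - b) ^ 2), sq_nonneg (a * (a - b)), sq_nonneg (b * (a - b))]
    have := this (c i * ε i ω ^ 2) (linForm ε (fun x => x) t c ω * ε i ω)
    calc (ε i ω * (c i * ε i ω + linForm ε (fun x => x) t c ω)) ^ 4
        = (c i * ε i ω ^ 2 + linForm ε (fun x => x) t c ω * ε i ω) ^ 4 := by ring
      _ ≤ _ := this
      _ = _ := by ring
  have iR : Integrable (fun ω => 8 * c i ^ 4 * ε i ω ^ 8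
      + 8 * (linForm ε (fun x => x) t c ω ^ 4 * ε i ω ^ 4)) μ :=
    (i8.const_mul _).add (iLX.const_mul _)
  have hmeas : AEStronglyMeasurable (fun ω => (ε i ω * ∑ j ∈ s, c j * ε j ω) ^ 4) μ := by
    have : AEStronglyMeasurable (fun ω => c i * ε i ω + linForm ε (fun x => x) t c ω) μ :=
      (h8i.1.const_mul _).add hL.1
    simp_rw [hsplit]
    exact (h8i.1.mul this).pow 4
  have iLHS : Integrable (fun ω => (ε i ω * ∑ j ∈ s, c j * ε j ω) ^ 4) μ :=
    iR.mono' hmeas (Eventually.of_forall fun ω => by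
      rw [Real.norm_of_nonneg (by positivity)]; exact hbd ω)
  refine ⟨iLHS, (integral_mono iLHS iR hbd).trans ?_⟩
  rw [integral_add (i8.const_mul _) (iLX.const_mul _), integral_const_mul, integral_const_mul,
    h.integral_mul_comp hit (hLm.pow_const 4) (hL.1.pow 4) (hid.pow_const 4),
    h.integral_comp (hid.pow_const 8) i]
  have hb := h.integral_linForm_pow_four_le hid h4 hz t c
  have hs : ∑ j ∈ s, c j ^ 2 = c i ^ 2 + ∑ j ∈ t, c j ^ 2 := (add_sum_erase s _ hi).symm
  rw [hs]
  set A := ∑ j ∈ t, c j ^ 2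
  set m4 := ∫ ω, ε 0 ω ^ 4 ∂μ
  set m8 := ∫ ω, ε 0 ω ^ 8 ∂μ
  have hA : 0 ≤ A := sum_nonneg fun j _ => sq_nonneg _
  have hm4 : 0 ≤ m4 := integral_nonneg fun ω => by positivity
  have hm8 : 0 ≤ m8 := integral_nonneg fun ω => by positivity
  have h1 : A ^ 2 ≤ (c i ^ 2 + A) ^ 2 := by gcongr; nlinarith [sq_nonneg (c i)]
  have h2 : c i ^ 4 ≤ (c i ^ 2 + A) ^ 2 := by nlinarith [mul_nonneg (sq_nonneg (c i)) hA]
  have h3 := mul_le_mul_of_nonneg_left h1 (by positivity : 0 ≤ 24 * m4 ^ 2)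
  have h4' := mul_le_mul_of_nonneg_left h2 (by positivity : 0 ≤ 8 * m8)
  have h5 := mul_le_mul_of_nonneg_right hb hm4
  nlinarith

/-- Adding the index `m` to a form with zero diagonal adds `A f(ε m) + B g(ε m)`, where `A` and `B`
are linear in the earlier variables. This increment is orthogonal to the old form. -/
theorem IsIID.integral_offDiag_sq_le (h : IsIID μ ε) {f g : ℝ → ℝ} (hf : Measurable f)
    (hg : Measurable g) (hf4 : MemLp (fun ω => f (ε 0 ω)) 4 μ)
    (hg4 : MemLp (fun ω => g (ε 0 ω)) 4 μ) (hfz : ∫ ω, f (ε 0 ω) ∂μ = 0)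
    (hgz : ∫ ω, g (ε 0 ω) ∂μ = 0) (s : Finset ℕ) (M : ℕ → ℕ → ℝ) (hM : ∀ i, M i i = 0) :
    ∫ ω, (∑ i ∈ s, ∑ j ∈ s, M i j * (f (ε i ω) * g (ε j ω))) ^ 2 ∂μ ≤
      2 * ((∫ ω, f (ε 0 ω) ^ 2 ∂μ) * ∫ ω, g (ε 0 ω) ^ 2 ∂μ) * ∑ i ∈ s, ∑ j ∈ s, M i j ^ 2 := by
  have hf2 : MemLp (fun ω => f (ε 0 ω)) 2 μ := hf4.mono_exponent (by norm_num)
  have hg2 : MemLp (fun ω => g (ε 0 ω)) 2 μ := hg4.mono_exponent (by norm_num)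
  induction s using Finset.induction_on with
  | empty => simp
  | insert m s hm ih =>
    set Q : Ω → ℝ := fun ω => ∑ i ∈ s, ∑ j ∈ s, M i j * (f (ε i ω) * g (ε j ω)) with hQdef
    set A := linForm ε g s (fun j => M m j) with hAdef
    set B := linForm ε f s (fun i => M i m) with hBdef
    have hQ : MemLp Q 2 μ := memLp_finsetSum _ fun i _ => memLp_finsetSum _ fun j _ =>
      (memLp_mul_four (h.memLp_comp hf hf4 i) (h.memLp_comp hg hg4 j)).const_mul _
    have hQm : Measurable[sigmaOf ε s] Q :=
      Finset.measurable_fun_sum _ fun i hi => Finset.measurable_fun_sum _ fun j hj =>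
        ((hf.comp (measurable_sigmaOf ε hi)).mul (hg.comp (measurable_sigmaOf ε hj))).const_mul _
    have hA : MemLp A 4 μ := h.memLp_linForm hg hg4 s _
    have hB : MemLp B 4 μ := h.memLp_linForm hf hf4 s _
    have hA2 : MemLp A 2 μ := hA.mono_exponent (by norm_num)
    have hB2 : MemLp B 2 μ := hB.mono_exponent (by norm_num)
    have hAm : Measurable[sigmaOf ε s] A := measurable_linForm ε hg s _
    have hBm : Measurable[sigmaOf ε s] B := measurable_linForm ε hf s _
    have hfm := h.memLp_comp hf hf4 m
    have hgm := h.memLp_comp hg hg4 m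
    have e : ∀ ω, (∑ i ∈ insert m s, ∑ j ∈ insert m s, M i j * (f (ε i ω) * g (ε j ω)))
        = Q ω + (A ω * f (ε m ω) + B ω * g (ε m ω)) := by
      intro ω
      simp only [hQdef, hAdef, hBdef, linForm]
      rw [sum_insert hm, sum_insert hm, hM]
      simp_rw [sum_insert hm]
      rw [sum_add_distrib, zero_mul, zero_add]
      have e₁ : ∑ j ∈ s, M m j * (f (ε m ω) * g (ε j ω))
          = (∑ j ∈ s, M m j * g (ε j ω)) * f (ε m ω) := by
        rw [sum_mul]; exact sum_congr rfl fun j _ => by ring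
      have e₂ : ∑ i ∈ s, M i m * (f (ε i ω) * g (ε m ω))
          = (∑ i ∈ s, M i m * f (ε i ω)) * g (ε m ω) := by
        rw [sum_mul]; exact sum_congr rfl fun i _ => by ring
      linarith
    -- Only the square of the increment is estimated, at the cost of the factor `2`. The cross terms
    -- with `Q` are kept exactly, since they have mean zero.
    have hbd : ∀ ω, (Q ω + (A ω * f (ε m ω) + B ω * g (ε m ω))) ^ 2 ≤
        Q ω ^ 2 + 2 * ((Q ω * A ω) * f (ε m ω)) + 2 * ((Q ω * B ω) * g (ε m ω))
          + 2 * (A ω ^ 2 * f (ε m ω) ^ 2) + 2 * (B ω ^ 2 * g (ε m ω) ^ 2) := by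
      intro ω
      nlinarith [sq_nonneg (A ω * f (ε m ω) - B ω * g (ε m ω))]
    have iQA : Integrable (fun ω => Q ω * A ω) μ := hQ.integrable_mul hA2
    have iQB : Integrable (fun ω => Q ω * B ω) μ := hQ.integrable_mul hB2
    have j0 := hQ.integrable_sq
    have j1 := (h.integrable_mul_comp (F := fun ω => Q ω * A ω) hm (hQm.mul hAm) iQA hf
      (hfm.integrable (by norm_num))).const_mul 2
    have j2 := (h.integrable_mul_comp (F := fun ω => Q ω * B ω) hm (hQm.mul hBm) iQB hg
      (hgm.integrable (by norm_num))).const_mul 2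
    have j3 := (h.integrable_mul_comp hm (hAm.pow_const 2) hA2.integrable_sq (hf.pow_const 2)
      (h.memLp_comp hf hf2 m).integrable_sq).const_mul 2
    have j4 := (h.integrable_mul_comp hm (hBm.pow_const 2) hB2.integrable_sq (hg.pow_const 2)
      (h.memLp_comp hg hg2 m).integrable_sq).const_mul 2
    have iL : Integrable (fun ω => (Q ω + (A ω * f (ε m ω) + B ω * g (ε m ω))) ^ 2) μ :=
      (hQ.add ((memLp_mul_four hA hfm).add (memLp_mul_four hB hgm))).integrable_sq
    simp_rw [e]
    refine (integral_mono iL ((((j0.add j1).add j2).add j3).add j4) hbd).trans ?_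
    simp only [Pi.add_apply]
    rw [integral_add_five j0 j1 j2 j3 j4, integral_const_mul, integral_const_mul,
      integral_const_mul, integral_const_mul,
      h.integral_mul_comp (F := fun ω => Q ω * A ω) hm (hQm.mul hAm) iQA.1 hf,
      h.integral_mul_comp (F := fun ω => Q ω * B ω) hm (hQm.mul hBm) iQB.1 hg,
      h.integral_mul_comp hm (hAm.pow_const 2) (hA.1.pow 2) (hf.pow_const 2),
      h.integral_mul_comp hm (hBm.pow_const 2) (hB.1.pow 2) (hg.pow_const 2),
      hfz, hgz, hAdef, hBdef, h.integral_linForm_sq hg hg2 hgz, h.integral_linForm_sq hf hf2 hfz]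
    have e2 : ∑ i ∈ insert m s, ∑ j ∈ insert m s, M i j ^ 2
        = ∑ i ∈ s, ∑ j ∈ s, M i j ^ 2 + ∑ j ∈ s, M m j ^ 2 + ∑ i ∈ s, M i m ^ 2 := by
      rw [sum_insert hm, sum_insert hm, hM]
      simp_rw [sum_insert hm]
      rw [sum_add_distrib]; ring
    rw [e2]
    nlinarith

/-- The form splits into its off-diagonal part, the centred diagonal, and the mean `c * ∑ M i i`.
The first two cost a Frobenius norm, while the mean is kept apart because a trace is not controlled
efficiently by that norm. -/
theorem IsIID.integral_bilin_sq_le (h : IsIID μ ε) {f g : ℝ → ℝ} (hf : Measurable f)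
    (hg : Measurable g) (hf4 : MemLp (fun ω => f (ε 0 ω)) 4 μ)
    (hg4 : MemLp (fun ω => g (ε 0 ω)) 4 μ) (hfz : ∫ ω, f (ε 0 ω) ∂μ = 0)
    (hgz : ∫ ω, g (ε 0 ω) ∂μ = 0) (s : Finset ℕ) (M : ℕ → ℕ → ℝ) :
    Integrable (fun ω => (∑ i ∈ s, ∑ j ∈ s, M i j * (f (ε i ω) * g (ε j ω))) ^ 2) μ ∧
    ∫ ω, (∑ i ∈ s, ∑ j ∈ s, M i j * (f (ε i ω) * g (ε j ω))) ^ 2 ∂μ ≤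
      (4 * ((∫ ω, f (ε 0 ω) ^ 2 ∂μ) * ∫ ω, g (ε 0 ω) ^ 2 ∂μ)
        + 4 * ∫ ω, (f (ε 0 ω) * g (ε 0 ω) - ∫ ω', f (ε 0 ω') * g (ε 0 ω') ∂μ) ^ 2 ∂μ)
          * ∑ i ∈ s, ∑ j ∈ s, M i j ^ 2
        + 4 * (∫ ω, f (ε 0 ω) * g (ε 0 ω) ∂μ) ^ 2 * (∑ i ∈ s, M i i) ^ 2 := by
  set c := ∫ ω, f (ε 0 ω) * g (ε 0 ω) ∂μ with hc
  set M' : ℕ → ℕ → ℝ := fun i j => if i = j then 0 else M i j with hM'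
  set φ : ℝ → ℝ := fun x => f x * g x - c with hφ
  have hφm : Measurable φ := (hf.mul hg).sub_const c
  have hfg := memLp_mul_four hf4 hg4
  have hφ2 : MemLp (fun ω => φ (ε 0 ω)) 2 μ := hfg.sub (memLp_const c)
  have hφz : ∫ ω, φ (ε 0 ω) ∂μ = 0 := by
    simp only [hφ]
    rw [integral_sub (hfg.integrable (by norm_num)) (integrable_const _)]
    simp [hc]
  set P : Ω → ℝ := fun ω => ∑ i ∈ s, ∑ j ∈ s, M' i j * (f (ε i ω) * g (ε j ω)) with hP
  set D := linForm ε φ s (fun i => M i i) with hD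
  set b := c * ∑ i ∈ s, M i i with hb
  have hPL : MemLp P 2 μ := memLp_finsetSum _ fun i _ => memLp_finsetSum _ fun j _ =>
      (memLp_mul_four (h.memLp_comp hf hf4 i) (h.memLp_comp hg hg4 j)).const_mul _
  have hDL : MemLp D 2 μ := h.memLp_linForm hφm hφ2 s _
  have e : ∀ ω, ∑ i ∈ s, ∑ j ∈ s, M i j * (f (ε i ω) * g (ε j ω)) = P ω + (D ω + b) := by
    intro ω
    simp only [hP, hD, hb, linForm, hφ, hM']
    rw [mul_sum, ← sum_add_distrib, ← sum_add_distrib]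
    refine sum_congr rfl fun i hi => ?_
    rw [← add_sum_erase s _ hi, ← add_sum_erase s (fun j => (if i = j then 0 else M i j) * _) hi]
    rw [if_pos rfl]
    have : ∑ j ∈ s.erase i, (if i = j then 0 else M i j) * (f (ε i ω) * g (ε j ω))
        = ∑ j ∈ s.erase i, M i j * (f (ε i ω) * g (ε j ω)) :=
      sum_congr rfl fun j hj => by rw [if_neg (ne_of_mem_erase hj).symm]
    rw [this]; ring
  simp_rw [e]
  have iL : Integrable (fun ω => (P ω + (D ω + b)) ^ 2) μ :=
    (hPL.add (hDL.add (memLp_const b))).integrable_sq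
  refine ⟨iL, ?_⟩
  have hbd : ∀ ω, (P ω + (D ω + b)) ^ 2 ≤ 2 * P ω ^ 2 + 4 * D ω ^ 2 + 4 * b ^ 2 := by
    intro ω
    nlinarith [sq_nonneg (P ω - (D ω + b)), sq_nonneg (D ω - b)]
  have j1 := hPL.integrable_sq.const_mul 2
  have j2 := hDL.integrable_sq.const_mul 4
  refine (integral_mono iL ((j1.add j2).add (integrable_const (4 * b ^ 2))) hbd).trans ?_
  simp only [Pi.add_apply]
  rw [integral_add_three j1 j2 (integrable_const _), integral_const_mul,
    integral_const_mul, integral_const]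
  have hPb := h.integral_offDiag_sq_le hf hg hf4 hg4 hfz hgz s M' (fun i => if_pos rfl)
  have hDb := h.integral_linForm_sq hφm hφ2 hφz s (fun i => M i i)
  rw [hDb]
  have hM1 : ∑ i ∈ s, ∑ j ∈ s, M' i j ^ 2 ≤ ∑ i ∈ s, ∑ j ∈ s, M i j ^ 2 :=
    sum_le_sum fun i _ => sum_le_sum fun j _ => by
      simp only [hM']; split_ifs <;> simp [sq_nonneg]
  have hM2 : ∑ i ∈ s, M i i ^ 2 ≤ ∑ i ∈ s, ∑ j ∈ s, M i j ^ 2 :=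
    sum_le_sum fun i hi => single_le_sum (f := fun j => M i j ^ 2) (fun j _ => sq_nonneg _) hi
  have hmf : 0 ≤ (∫ ω, f (ε 0 ω) ^ 2 ∂μ) * ∫ ω, g (ε 0 ω) ^ 2 ∂μ :=
    mul_nonneg (integral_nonneg fun ω => sq_nonneg _) (integral_nonneg fun ω => sq_nonneg _)
  have hmφ : 0 ≤ ∫ ω, φ (ε 0 ω) ^ 2 ∂μ := integral_nonneg fun ω => sq_nonneg _
  have h1 := mul_le_mul_of_nonneg_left hM1 hmf
  have h2 := mul_le_mul_of_nonneg_left hM2 hmφ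
  have hbe : b ^ 2 = c ^ 2 * (∑ i ∈ s, M i i) ^ 2 := by rw [hb]; ring
  simp only [probReal_univ, smul_eq_mul, one_mul]
  rw [hbe]
  have hvar : ∫ ω, (f (ε 0 ω) * g (ε 0 ω) - c) ^ 2 ∂μ = ∫ ω, φ (ε 0 ω) ^ 2 ∂μ := rfl
  rw [hvar]
  change ∫ ω, P ω ^ 2 ∂μ ≤ _ at hPb
  nlinarith

end Moments

/-! ### Linear algebra of the design and the deterministic expansion. -/

section Design

variable {p n : ℕ} {a b : ℕ → Fin p → ℝ} {σ2 C₀ C₁ L : ℝ}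

/-- The vectors `b i` are the images of the `a i` under the inverse of `V = n⁻¹ σ² ∑ a_i a_iᵗ`; the
eigenvalues of `V` are between `C₀` and `C₁`, and the `a i` have squared norm at most `L`. -/
structure IsDualDesign (n : ℕ) (a b : ℕ → Fin p → ℝ) (σ2 C₀ C₁ L : ℝ) : Prop where
  n_pos : (0 : ℝ) < n
  var_pos : 0 < σ2
  lower_pos : 0 < C₀
  upper_pos : 0 < C₁
  bound_pos : 0 < L
  dual : ∀ i ∈ range n, σ2 • ∑ j ∈ range n, (b i ⬝ᵥ a j) • a j = (n : ℝ) • a i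
  lower : ∀ v : Fin p → ℝ, n * C₀ * (v ⬝ᵥ v) ≤ σ2 * ∑ j ∈ range n, (v ⬝ᵥ a j) ^ 2
  upper : ∀ v : Fin p → ℝ, σ2 * ∑ j ∈ range n, (v ⬝ᵥ a j) ^ 2 ≤ n * C₁ * (v ⬝ᵥ v)
  bound : ∀ i ∈ range n, a i ⬝ᵥ a i ≤ L

theorem IsDualDesign.mul_dotProduct (D : IsDualDesign n a b σ2 C₀ C₁ L) {i : ℕ} (hi : i ∈ range n)
    (v : Fin p → ℝ) :
    n * (v ⬝ᵥ a i) = σ2 * ∑ k ∈ range n, (b i ⬝ᵥ a k) * (v ⬝ᵥ a k) := by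
  have := congrArg (fun w => v ⬝ᵥ w) (D.dual i hi)
  simp only [dotProduct_smul, dotProduct_sum, smul_eq_mul] at this
  exact this.symm

theorem IsDualDesign.dotProduct_comm (D : IsDualDesign n a b σ2 C₀ C₁ L) {i j : ℕ}
    (hi : i ∈ range n) (hj : j ∈ range n) : b i ⬝ᵥ a j = b j ⬝ᵥ a i := by
  have h1 := D.mul_dotProduct hj (b i)
  have h2 := D.mul_dotProduct hi (b j)
  have h3 : (n : ℝ) * (b i ⬝ᵥ a j) = n * (b j ⬝ᵥ a i) := by
    rw [h1, h2]
    congr 1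
    exact sum_congr rfl fun k _ => mul_comm _ _
  exact mul_left_cancel₀ D.n_pos.ne' h3

theorem IsDualDesign.lower' (D : IsDualDesign n a b σ2 C₀ C₁ L) (v : Fin p → ℝ) :
    n * C₀ / σ2 * (v ⬝ᵥ v) ≤ ∑ j ∈ range n, (v ⬝ᵥ a j) ^ 2 := by
  rw [div_mul_eq_mul_div, div_le_iff₀ D.var_pos, mul_comm _ σ2]
  exact D.lower v

/-- By symmetry of `b i · a j = a i · V⁻¹ a j`, the sum is the quadratic form of the design at `b i
= V⁻¹ a i`, and `V⁻¹` is at most `1 / C₀`. -/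
theorem IsDualDesign.sum_sq_le (D : IsDualDesign n a b σ2 C₀ C₁ L) {i : ℕ} (hi : i ∈ range n) :
    ∑ j ∈ range n, (b j ⬝ᵥ a i) ^ 2 ≤ n * (L / (σ2 * C₀)) := by
  have hn := D.n_pos
  have hσ := D.var_pos
  have hC := D.lower_pos
  have e : ∑ j ∈ range n, (b j ⬝ᵥ a i) ^ 2 = ∑ j ∈ range n, (b i ⬝ᵥ a j) ^ 2 :=
    sum_congr rfl fun j hj => by rw [D.dotProduct_comm hj hi]
  have hd : ∑ j ∈ range n, (b i ⬝ᵥ a j) • a j = ((n : ℝ) / σ2) • a i := by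
    rw [div_eq_inv_mul, mul_smul, ← D.dual i hi, smul_smul, inv_mul_cancel₀ hσ.ne', one_smul]
  rw [e]
  refine (sum_dotProduct_sq_le (by positivity) D.lower' hd).trans ?_
  rw [smul_dotProduct, dotProduct_smul, smul_eq_mul, smul_eq_mul]
  calc (n / σ2 * (n / σ2 * (a i ⬝ᵥ a i))) / (n * C₀ / σ2)
      = n * ((a i ⬝ᵥ a i) / (σ2 * C₀)) := by field_simp
    _ ≤ n * (L / (σ2 * C₀)) := by
      have := D.bound i hi
      gcongr

/-- The diagonal entry `b i · a i` is itself `σ2 / n` times the sum of squares bounded in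
`IsDualDesign.sum_sq_le`, which gives both its sign and its size. -/
theorem IsDualDesign.diag_sq_le (D : IsDualDesign n a b σ2 C₀ C₁ L) {i : ℕ} (hi : i ∈ range n) :
    (b i ⬝ᵥ a i) ^ 2 ≤ (L / C₀) ^ 2 := by
  have hn := D.n_pos
  have hσ := D.var_pos
  have hC := D.lower_pos
  have h1 := D.mul_dotProduct hi (b i)
  have e : ∑ k ∈ range n, (b i ⬝ᵥ a k) * (b i ⬝ᵥ a k) = ∑ k ∈ range n, (b k ⬝ᵥ a i) ^ 2 :=
    sum_congr rfl fun k hk => by rw [D.dotProduct_comm hi hk, sq]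
  rw [e] at h1
  have h2 := D.sum_sq_le hi
  have h3 : (0 : ℝ) ≤ ∑ k ∈ range n, (b k ⬝ᵥ a i) ^ 2 := sum_nonneg fun k _ => sq_nonneg _
  have h4 : 0 ≤ b i ⬝ᵥ a i := by
    have : 0 ≤ n * (b i ⬝ᵥ a i) := by rw [h1]; positivity
    exact nonneg_of_mul_nonneg_right this hn
  refine pow_le_pow_left₀ h4 ?_ 2
  have : n * (b i ⬝ᵥ a i) ≤ n * (L / C₀) := by
    rw [h1]
    calc σ2 * ∑ k ∈ range n, (b k ⬝ᵥ a i) ^ 2 ≤ σ2 * (n * (L / (σ2 * C₀))) := by gcongr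
      _ = n * (L / C₀) := by field_simp
  exact le_of_mul_le_mul_left this hn

/-- A linear map and its adjoint have the same norm, so the upper eigenvalue bound also controls `c
↦ ∑ c i • a i`. Compared with the triangle inequality this saves a factor `L`, of order `p`, in the
trace part of the residual. -/
theorem IsDualDesign.sum_smul_dotProduct_self_le (D : IsDualDesign n a b σ2 C₀ C₁ L)
    (c : ℕ → ℝ) :
    (∑ i ∈ range n, c i • a i) ⬝ᵥ (∑ i ∈ range n, c i • a i) ≤
      n * C₁ / σ2 * ∑ i ∈ range n, c i ^ 2 := by
  set w := ∑ i ∈ range n, c i • a i with hw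
  have hσ := D.var_pos
  have h1 : w ⬝ᵥ w = ∑ i ∈ range n, c i * (w ⬝ᵥ a i) := by
    conv_lhs => rw [hw, ← hw, dotProduct_sum]
    exact sum_congr rfl fun i _ => by rw [dotProduct_smul, smul_eq_mul]
  have h2 := sum_mul_sq_le_sq_mul_sq (range n) c (fun i => w ⬝ᵥ a i)
  rw [← h1] at h2
  have h3 : ∑ i ∈ range n, (w ⬝ᵥ a i) ^ 2 ≤ n * C₁ / σ2 * (w ⬝ᵥ w) := by
    rw [div_mul_eq_mul_div, le_div_iff₀ hσ, mul_comm _ σ2]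
    exact D.upper w
  have hc : 0 ≤ ∑ i ∈ range n, c i ^ 2 := sum_nonneg fun i _ => sq_nonneg _
  rcases (dotProduct_self_nonneg' w).eq_or_lt with h0 | h0
  · rw [← h0]
    have := D.upper_pos
    have := D.n_pos
    positivity
  · have : (w ⬝ᵥ w) * (w ⬝ᵥ w) ≤ (w ⬝ᵥ w) * (n * C₁ / σ2 * ∑ i ∈ range n, c i ^ 2) := by
      calc (w ⬝ᵥ w) * (w ⬝ᵥ w) = (w ⬝ᵥ w) ^ 2 := by ring
        _ ≤ _ := h2
        _ ≤ (∑ i ∈ range n, c i ^ 2) * (n * C₁ / σ2 * (w ⬝ᵥ w)) := by gcongr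
        _ = _ := by ring
    exact le_of_mul_le_mul_left this h0

/-- The first-order approximation `V⁻¹ ψ` of the multiplier. -/
noncomputable def pilot (n : ℕ) (b : ℕ → Fin p → ℝ) (e : ℕ → ℝ) : Fin p → ℝ :=
  (n : ℝ)⁻¹ • ∑ j ∈ range n, e j • b j

theorem pilot_dotProduct (e : ℕ → ℝ) (v : Fin p → ℝ) :
    pilot n b e ⬝ᵥ v = (n : ℝ)⁻¹ * ∑ j ∈ range n, (b j ⬝ᵥ v) * e j := by
  rw [pilot, smul_dotProduct, sum_dotProduct, smul_eq_mul]
  congr 1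
  exact sum_congr rfl fun j _ => by rw [smul_dotProduct, smul_eq_mul, mul_comm]

/-- This is the equation `V x = ψ` for the pilot `x`, multiplied by `n`. -/
theorem IsDualDesign.sum_pilot (D : IsDualDesign n a b σ2 C₀ C₁ L) (e : ℕ → ℝ) :
    σ2 • ∑ i ∈ range n, (pilot n b e ⬝ᵥ a i) • a i = ∑ j ∈ range n, e j • a j := by
  have hn := D.n_pos
  have : ∀ i, (pilot n b e ⬝ᵥ a i) • a i
      = ∑ j ∈ range n, ((n : ℝ)⁻¹ * e j) • ((b j ⬝ᵥ a i) • a i) := by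
    intro i
    rw [pilot_dotProduct, mul_sum, sum_smul]
    exact sum_congr rfl fun j _ => by rw [smul_smul]; congr 1; ring
  simp_rw [this]
  rw [sum_comm, smul_sum]
  refine sum_congr rfl fun j hj => ?_
  rw [← smul_sum, smul_comm, D.dual j hj, smul_smul]
  congr 1
  field_simp

theorem IsDualDesign.pilot_sq_le (D : IsDualDesign n a b σ2 C₀ C₁ L) (e : ℕ → ℝ) :
    (n * C₀) ^ 2 * (pilot n b e ⬝ᵥ pilot n b e) ≤
      (∑ j ∈ range n, e j • a j) ⬝ᵥ (∑ j ∈ range n, e j • a j) := by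
  have hn := D.n_pos
  have hσ := D.var_pos
  have hC := D.lower_pos
  set x := pilot n b e
  set g := ∑ j ∈ range n, e j • a j
  have hd : ∑ i ∈ range n, (x ⬝ᵥ a i) • a i = σ2⁻¹ • g := by
    have hg : σ2 • ∑ i ∈ range n, (x ⬝ᵥ a i) • a i = g := D.sum_pilot e
    rw [← hg, smul_smul, inv_mul_cancel₀ hσ.ne', one_smul]
  have h1 := (D.lower' x).trans (sum_dotProduct_sq_le (by positivity) D.lower' hd)
  rw [smul_dotProduct, dotProduct_smul, smul_eq_mul, smul_eq_mul, le_div_iff₀ (by positivity)] at h1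
  have h2 := mul_le_mul_of_nonneg_left h1 (sq_nonneg σ2)
  calc (n * C₀) ^ 2 * (x ⬝ᵥ x) = σ2 ^ 2 * (n * C₀ / σ2 * (x ⬝ᵥ x) * (n * C₀ / σ2)) := by
        field_simp
    _ ≤ _ := h2
    _ = g ⬝ᵥ g := by field_simp

/-- The error `n (V - S) V⁻¹ ψ` of the first-order approximation in the linearized score
equation. -/
noncomputable def linError (n : ℕ) (a b : ℕ → Fin p → ℝ) (e : ℕ → ℝ) : Fin p → ℝ :=
  ∑ j ∈ range n, e j • a j - ∑ i ∈ range n, (pilot n b e ⬝ᵥ (e i • a i)) • (e i • a i)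

/-- Since the pilot solves its equation with `σ2` in place of `e i ^ 2`, only the centred squares
survive, and each coordinate is a bilinear form in two centred functions of the errors. -/
theorem IsDualDesign.linError_apply (D : IsDualDesign n a b σ2 C₀ C₁ L) (e : ℕ → ℝ) (r : Fin p) :
    linError n a b e r = -(n : ℝ)⁻¹ * ∑ i ∈ range n, ∑ j ∈ range n,
      ((b j ⬝ᵥ a i) * a i r) * ((e i ^ 2 - σ2) * e j) := by
  have h1 : linError n a b e = -∑ i ∈ range n, ((e i ^ 2 - σ2) * (pilot n b e ⬝ᵥ a i)) • a i := by
    rw [linError, ← D.sum_pilot e, smul_sum, ← sum_sub_distrib, ← sum_neg_distrib]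
    refine sum_congr rfl fun i _ => ?_
    rw [dotProduct_smul, smul_smul, smul_smul, ← sub_smul, ← neg_smul, smul_eq_mul]
    congr 1
    ring
  rw [h1, Pi.neg_apply, Finset.sum_apply, neg_mul, mul_sum]
  congr 1
  refine sum_congr rfl fun i _ => ?_
  rw [Pi.smul_apply, pilot_dotProduct, smul_eq_mul, mul_sum, mul_sum, mul_sum, sum_mul]
  exact sum_congr rfl fun j _ => by ring

/-- The squared Frobenius norm of `n (S - V)`. -/
noncomputable def frobError (n : ℕ) (a : ℕ → Fin p → ℝ) (σ2 : ℝ) (e : ℕ → ℝ) : ℝ :=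
  ∑ r, ∑ s, (∑ i ∈ range n, (a i r * a i s) * (e i ^ 2 - σ2)) ^ 2

/-- The Frobenius norm dominates the operator norm of `n (S - V)`, so half of the lower eigenvalue
bound passes from `V` to `S`. -/
theorem IsDualDesign.lower_of_frobError_le (D : IsDualDesign n a b σ2 C₀ C₁ L) {e : ℕ → ℝ}
    (he : frobError n a σ2 e ≤ (n * C₀ / 2) ^ 2) (v : Fin p → ℝ) :
    n * C₀ / 2 * (v ⬝ᵥ v) ≤ ∑ i ∈ range n, (v ⬝ᵥ (e i • a i)) ^ 2 := by
  have hn := D.n_pos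
  have hC := D.lower_pos
  set E : Fin p → Fin p → ℝ := fun r s => ∑ i ∈ range n, (a i r * a i s) * (e i ^ 2 - σ2) with hE
  have h1 : ∑ i ∈ range n, (v ⬝ᵥ (e i • a i)) ^ 2
      = σ2 * ∑ i ∈ range n, (v ⬝ᵥ a i) ^ 2 + ∑ r, ∑ s, (v r * v s) * E r s := by
    have h2 : ∑ r, ∑ s, (v r * v s) * E r s
        = ∑ i ∈ range n, (e i ^ 2 - σ2) * (v ⬝ᵥ a i) ^ 2 := by
      simp only [hE, mul_sum]
      rw [sum_congr rfl fun r _ => sum_comm, sum_comm]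
      refine sum_congr rfl fun i _ => ?_
      rw [sq (v ⬝ᵥ a i), dotProduct, sum_mul_sum, mul_sum]
      refine sum_congr rfl fun r _ => ?_
      rw [mul_sum]
      exact sum_congr rfl fun s _ => by ring
    rw [h2, mul_sum, ← sum_add_distrib]
    refine sum_congr rfl fun i _ => ?_
    rw [dotProduct_smul, smul_eq_mul]; ring
  have h3 : (∑ r, ∑ s, (v r * v s) * E r s) ^ 2 ≤ (v ⬝ᵥ v) ^ 2 * frobError n a σ2 e := by
    have := sum_mul_sq_le_sq_mul_sq (univ ×ˢ univ : Finset (Fin p × Fin p))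
      (fun x => v x.1 * v x.2) (fun x => E x.1 x.2)
    rw [sum_product, sum_product, sum_product] at this
    refine this.trans (le_of_eq ?_)
    rw [frobError]
    congr 1
    rw [sq (v ⬝ᵥ v), dotProduct, sum_mul_sum]
    exact sum_congr rfl fun r _ => sum_congr rfl fun s _ => by ring
  have hv := dotProduct_self_nonneg' v
  have h4 : |∑ r, ∑ s, (v r * v s) * E r s| ≤ n * C₀ / 2 * (v ⬝ᵥ v) := by
    apply abs_le_of_sq_le_sq _ (by positivity)
    refine h3.trans ?_
    rw [mul_pow, mul_comm]
    gcongr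
  have h5 := (abs_le.1 h4).1
  have h6 := D.lower v
  rw [h1]
  linarith

theorem dotProduct_smul_self (c : ℝ) (v : Fin p → ℝ) : (c • v) ⬝ᵥ (c • v) = c ^ 2 * (v ⬝ᵥ v) := by
  rw [smul_dotProduct, dotProduct_smul, smul_eq_mul, smul_eq_mul]; ring

/-- The empirical likelihood statistic under a favourable realization `e` of the errors. -/
theorem IsDualDesign.expansion (D : IsDualDesign n a b σ2 C₀ C₁ L) {e : ℕ → ℝ} {M τ : ℝ}
    (hM : 0 < M) (hτ : 0 < τ) (he : frobError n a σ2 e ≤ (n * C₀ / 2) ^ 2)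
    (heM : ∀ i ∈ range n, e i ^ 2 * L ≤ M)
    (hg : 1296 * M * ((∑ i ∈ range n, e i • a i) ⬝ᵥ (∑ i ∈ range n, e i • a i)) < (n * C₀) ^ 2) :
    ∃ lam, IsOneSampleMultiplier (range n) (fun i => e i • a i) lam ∧
      ∀ y : Fin p → ℝ,
        (∀ v : Fin p → ℝ, ∑ i ∈ range n, (y ⬝ᵥ (e i • a i)) * (v ⬝ᵥ (e i • a i))
          = v ⬝ᵥ ∑ i ∈ range n, e i • a i) →
        |2 * ∑ i ∈ range n, Real.log (1 + lam ⬝ᵥ (e i • a i)) - y ⬝ᵥ ∑ i ∈ range n, e i • a i| ≤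
          52 / (n * C₀) * (linError n a b e ⬝ᵥ linError n a b e)
          + (100 + 4 / τ) * ∑ i ∈ range n, (pilot n b e ⬝ᵥ (e i • a i)) ^ 4
          + 4 * (n * τ ^ 3) := by
  have hn := D.n_pos
  have hC := D.lower_pos
  have hB := D.lower_of_frobError_le he
  have hu : ∀ i ∈ range n, (e i • a i) ⬝ᵥ (e i • a i) ≤ M := by
    intro i hi
    rw [dotProduct_smul_self]
    exact (mul_le_mul_of_nonneg_left (D.bound i hi) (sq_nonneg _)).trans (heM i hi)
  set g := ∑ i ∈ range n, e i • a i with hgdef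
  have hg0 := dotProduct_self_nonneg' g
  -- The lower bound for `n S` is `n * C₀ / 2`, whence `1296 = 4 * 324`.
  obtain ⟨lam, hlam, hl, hmax⟩ := exists_isOneSampleMultiplier (c := n * C₀ / 2) (by positivity)
    hM hu hB (by rw [div_pow]; linarith)
  refine ⟨lam, hlam, fun y hy => ?_⟩
  have hx : 4 * M * (pilot n b e ⬝ᵥ pilot n b e) ≤ 1 := by
    have h1 := mul_le_mul_of_nonneg_left (D.pilot_sq_le e) hM.le
    have h2 : (n * C₀) ^ 2 * (4 * M * (pilot n b e ⬝ᵥ pilot n b e)) ≤ (n * C₀) ^ 2 * 1 := by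
      have := mul_nonneg hM.le hg0
      linarith
    exact le_of_mul_le_mul_left h2 (by positivity)
  refine (abs_two_mul_sum_log_sub_le hτ hu hl hmax hx hy).trans ?_
  -- Next, `y - x` is identified as the solution of the linearized equation with right-hand side
  -- `linError`; this turns its quadratic form into `|linError|²` over the lower bound of `n S`.
  rw [card_range]
  have hlin : ∑ i ∈ range n, ((y - pilot n b e) ⬝ᵥ (e i • a i)) • (e i • a i)
      = linError n a b e := by
    have hy' : ∑ i ∈ range n, (y ⬝ᵥ (e i • a i)) • (e i • a i) = g := by
      refine dotProduct_eq _ _ fun v => ?_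
      rw [_root_.dotProduct_comm, _root_.dotProduct_comm g, ← hy v, dotProduct_sum]
      exact sum_congr rfl fun i _ => by rw [dotProduct_smul (y ⬝ᵥ e i • a i), smul_eq_mul]
    rw [linError, ← hgdef, ← hy', ← sum_sub_distrib]
    exact sum_congr rfl fun i _ => by rw [sub_dotProduct, sub_smul]
  have h3 := sum_dotProduct_sq_le (by positivity) hB hlin
  have h4 : linError n a b e ⬝ᵥ linError n a b e / (n * C₀ / 2)
      = 2 / (n * C₀) * (linError n a b e ⬝ᵥ linError n a b e) := by field_simp
  rw [h4] at h3
  have e5 : 52 / (n * C₀) * (linError n a b e ⬝ᵥ linError n a b e)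
      = 26 * (2 / (n * C₀) * (linError n a b e ⬝ᵥ linError n a b e)) := by ring
  rw [e5]
  gcongr

end Design

/-! ### Expected size of the random quantities in the expansion. -/

section DesignMoments

variable {Ω : Type*} [MeasurableSpace Ω] {μ : Measure Ω} [IsProbabilityMeasure μ]
  {ε : ℕ → Ω → ℝ} {p n : ℕ} {a b : ℕ → Fin p → ℝ} {σ2 C₀ C₁ L : ℝ}

theorem IsIID.integral_sum_dotProduct_self (h : IsIID μ ε) (h2 : MemLp (ε 0) 2 μ)
    (hz : ∫ ω, ε 0 ω ∂μ = 0) (hσ : ∫ ω, ε 0 ω ^ 2 ∂μ = σ2)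
    (D : IsDualDesign n a b σ2 C₀ C₁ L) :
    Integrable (fun ω => (∑ i ∈ range n, ε i ω • a i) ⬝ᵥ (∑ i ∈ range n, ε i ω • a i)) μ ∧
    ∫ ω, (∑ i ∈ range n, ε i ω • a i) ⬝ᵥ (∑ i ∈ range n, ε i ω • a i) ∂μ ≤ σ2 * (n * L) := by
  have hid : Measurable (fun x : ℝ => x) := measurable_id
  have e : ∀ ω, (∑ i ∈ range n, ε i ω • a i) ⬝ᵥ (∑ i ∈ range n, ε i ω • a i)
      = ∑ r, linForm ε (fun x => x) (range n) (fun i => a i r) ω ^ 2 := by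
    intro ω
    rw [dotProduct]
    refine sum_congr rfl fun r _ => ?_
    simp only [linForm, Finset.sum_apply, Pi.smul_apply, smul_eq_mul]
    rw [← sq]
    congr 1
    exact sum_congr rfl fun i _ => mul_comm _ _
  have hi : ∀ r ∈ (univ : Finset (Fin p)),
      Integrable (fun ω => linForm ε (fun x => x) (range n) (fun i => a i r) ω ^ 2) μ :=
    fun r _ => (h.memLp_linForm hid h2 (range n) fun i => a i r).integrable_sq
  simp_rw [e]
  refine ⟨integrable_finsetSum _ hi, ?_⟩
  rw [integral_finsetSum _ hi]
  simp_rw [h.integral_linForm_sq hid h2 hz, hσ]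
  rw [← mul_sum, sum_comm]
  refine mul_le_mul_of_nonneg_left ?_ D.var_pos.le
  calc ∑ i ∈ range n, ∑ r, a i r ^ 2 ≤ ∑ _i ∈ range n, L := sum_le_sum fun i hi => by
        have := D.bound i hi
        simpa [dotProduct, sq] using this
    _ = n * L := by simp

theorem IsIID.integral_frobError (h : IsIID μ ε) (h4 : MemLp (ε 0) 4 μ)
    (hσ : ∫ ω, ε 0 ω ^ 2 ∂μ = σ2) (D : IsDualDesign n a b σ2 C₀ C₁ L) :
    Integrable (fun ω => frobError n a σ2 (fun i => ε i ω)) μ ∧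
    ∫ ω, frobError n a σ2 (fun i => ε i ω) ∂μ ≤
      (∫ ω, (ε 0 ω ^ 2 - σ2) ^ 2 ∂μ) * (n * L ^ 2) := by
  have hf : Measurable (fun x : ℝ => x ^ 2 - σ2) := by fun_prop
  have h2 : MemLp (fun ω => ε 0 ω ^ 2) 2 μ := by
    simp_rw [sq]
    exact memLp_mul_four h4 h4
  have hf2 : MemLp (fun ω => ε 0 ω ^ 2 - σ2) 2 μ := h2.sub (memLp_const σ2)
  have hfz : ∫ ω, (ε 0 ω ^ 2 - σ2) ∂μ = 0 := by
    rw [integral_sub (h2.integrable (by norm_num)) (integrable_const _), hσ]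
    simp
  have hi : ∀ r s : Fin p, Integrable (fun ω => (∑ i ∈ range n,
      (a i r * a i s) * (ε i ω ^ 2 - σ2)) ^ 2) μ :=
    fun r s => (h.memLp_linForm hf hf2 (range n) fun i => a i r * a i s).integrable_sq
  have hi' : ∀ r ∈ (univ : Finset (Fin p)), Integrable (fun ω => ∑ s, (∑ i ∈ range n,
      (a i r * a i s) * (ε i ω ^ 2 - σ2)) ^ 2) μ :=
    fun r _ => integrable_finsetSum _ fun s _ => hi r s
  refine ⟨integrable_finsetSum _ hi', ?_⟩
  simp only [frobError]
  rw [integral_finsetSum _ hi']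
  have e : ∀ r s : Fin p, ∫ ω, (∑ i ∈ range n, (a i r * a i s) * (ε i ω ^ 2 - σ2)) ^ 2 ∂μ
      = (∫ ω, (ε 0 ω ^ 2 - σ2) ^ 2 ∂μ) * ∑ i ∈ range n, (a i r * a i s) ^ 2 :=
    fun r s => h.integral_linForm_sq hf hf2 hfz (range n) fun i => a i r * a i s
  have e' : ∀ r : Fin p, ∫ ω, ∑ s, (∑ i ∈ range n, (a i r * a i s) * (ε i ω ^ 2 - σ2)) ^ 2 ∂μ
      = (∫ ω, (ε 0 ω ^ 2 - σ2) ^ 2 ∂μ) * ∑ i ∈ range n, ∑ s, (a i r * a i s) ^ 2 := by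
    intro r
    rw [integral_finsetSum _ fun s _ => hi r s, sum_comm, mul_sum]
    exact sum_congr rfl fun s _ => e r s
  simp_rw [e']
  rw [← mul_sum, sum_comm]
  refine mul_le_mul_of_nonneg_left ?_ (integral_nonneg fun ω => sq_nonneg _)
  calc ∑ i ∈ range n, ∑ r, ∑ s, (a i r * a i s) ^ 2 ≤ ∑ _i ∈ range n, L ^ 2 :=
        sum_le_sum fun i hi => by
          have h1 : ∑ r, ∑ s, (a i r * a i s) ^ 2 = (a i ⬝ᵥ a i) ^ 2 := by
            rw [sq (a i ⬝ᵥ a i), dotProduct, sum_mul_sum]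
            exact sum_congr rfl fun r _ => sum_congr rfl fun s _ => by ring
          rw [h1]
          exact pow_le_pow_left₀ (dotProduct_self_nonneg' _) (D.bound i hi) 2
    _ = n * L ^ 2 := by simp

theorem IsIID.integral_sum_pilot_pow_four (h : IsIID μ ε) (h8 : MemLp (ε 0) 8 μ)
    (hz : ∫ ω, ε 0 ω ∂μ = 0) (D : IsDualDesign n a b σ2 C₀ C₁ L) :
    Integrable (fun ω => ∑ i ∈ range n,
      (pilot n b (fun j => ε j ω) ⬝ᵥ (ε i ω • a i)) ^ 4) μ ∧
    ∫ ω, ∑ i ∈ range n, (pilot n b (fun j => ε j ω) ⬝ᵥ (ε i ω • a i)) ^ 4 ∂μ ≤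
      8 * (∫ ω, ε 0 ω ^ 8 ∂μ + 3 * (∫ ω, ε 0 ω ^ 4 ∂μ) ^ 2) * (L / (σ2 * C₀)) ^ 2 / n := by
  have hn := D.n_pos
  have e : ∀ ω i, (pilot n b (fun j => ε j ω) ⬝ᵥ (ε i ω • a i)) ^ 4
      = (n : ℝ)⁻¹ ^ 4 * (ε i ω * ∑ j ∈ range n, (b j ⬝ᵥ a i) * ε j ω) ^ 4 := by
    intro ω i
    rw [dotProduct_smul, pilot_dotProduct, smul_eq_mul]; ring
  simp_rw [e]
  have hb := fun i (hi : i ∈ range n) =>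
    h.integral_mul_linForm_pow_four_le h8 hz hi (fun j => b j ⬝ᵥ a i)
  have hi := fun i (hi : i ∈ range n) => ((hb i hi).1.const_mul ((n : ℝ)⁻¹ ^ 4))
  refine ⟨integrable_finsetSum _ hi, ?_⟩
  rw [integral_finsetSum _ hi]
  have h4 : (0 : ℝ) ≤ 8 * (∫ ω, ε 0 ω ^ 8 ∂μ + 3 * (∫ ω, ε 0 ω ^ 4 ∂μ) ^ 2) := by
    have : 0 ≤ ∫ ω, ε 0 ω ^ 8 ∂μ := integral_nonneg fun ω => by positivity
    positivity
  set K := 8 * (∫ ω, ε 0 ω ^ 8 ∂μ + 3 * (∫ ω, ε 0 ω ^ 4 ∂μ) ^ 2)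
  calc ∑ i ∈ range n, ∫ ω, (n : ℝ)⁻¹ ^ 4 * (ε i ω * ∑ j ∈ range n, (b j ⬝ᵥ a i) * ε j ω) ^ 4 ∂μ
      ≤ ∑ _i ∈ range n, (n : ℝ)⁻¹ ^ 4 * (K * (n * (L / (σ2 * C₀))) ^ 2) := by
        refine sum_le_sum fun i hi => ?_
        rw [integral_const_mul]
        refine mul_le_mul_of_nonneg_left ((hb i hi).2.trans ?_) (by positivity)
        refine mul_le_mul_of_nonneg_left ?_ h4
        exact pow_le_pow_left₀ (sum_nonneg fun j _ => sq_nonneg _) (D.sum_sq_le hi) 2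
    _ = K * (L / (σ2 * C₀)) ^ 2 / n := by
        rw [sum_const, card_range, nsmul_eq_mul]
        field_simp

theorem IsIID.integral_linError_sq (h : IsIID μ ε) (h8 : MemLp (ε 0) 8 μ)
    (hz : ∫ ω, ε 0 ω ∂μ = 0) (hσ : ∫ ω, ε 0 ω ^ 2 ∂μ = σ2)
    (D : IsDualDesign n a b σ2 C₀ C₁ L) :
    Integrable (fun ω => linError n a b (fun i => ε i ω) ⬝ᵥ linError n a b (fun i => ε i ω)) μ ∧
    ∫ ω, linError n a b (fun i => ε i ω) ⬝ᵥ linError n a b (fun i => ε i ω) ∂μ ≤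
      (4 * ((∫ ω, (ε 0 ω ^ 2 - σ2) ^ 2 ∂μ) * σ2)
        + 4 * ∫ ω, ((ε 0 ω ^ 2 - σ2) * ε 0 ω
          - ∫ ω', (ε 0 ω' ^ 2 - σ2) * ε 0 ω' ∂μ) ^ 2 ∂μ) * (L ^ 2 / (σ2 * C₀))
        + 4 * (∫ ω, (ε 0 ω ^ 2 - σ2) * ε 0 ω ∂μ) ^ 2 * (C₁ / σ2 * (L / C₀) ^ 2) := by
  have hn := D.n_pos
  have hσ0 := D.var_pos
  have hC₀ := D.lower_pos
  have hC₁ := D.upper_pos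
  have hL := D.bound_pos
  have hid : Measurable (fun x : ℝ => x) := measurable_id
  have hf : Measurable (fun x : ℝ => x ^ 2 - σ2) := by fun_prop
  have h4 : MemLp (ε 0) 4 μ := h8.mono_exponent (by norm_num)
  have h24 : MemLp (fun ω => ε 0 ω ^ 2) 4 μ := by
    have : ENNReal.HolderTriple 8 8 4 := ⟨by
      rw [← two_mul, show (8 : ℝ≥0∞) = 2 * 4 by norm_num,
        ENNReal.mul_inv (Or.inl (by norm_num)) (Or.inl (by norm_num)), ← mul_assoc,
        ENNReal.mul_inv_cancel (by norm_num) (by norm_num), one_mul]⟩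
    simp_rw [sq]
    exact h8.mul' h8
  have hf4 : MemLp (fun ω => ε 0 ω ^ 2 - σ2) 4 μ := h24.sub (memLp_const σ2)
  have hfz : ∫ ω, (ε 0 ω ^ 2 - σ2) ∂μ = 0 := by
    rw [integral_sub (h24.integrable (by norm_num)) (integrable_const _), hσ]
    simp
  have hb := fun r : Fin p => h.integral_bilin_sq_le hf hid hf4 h4 hfz hz (range n)
    (fun i j => (b j ⬝ᵥ a i) * a i r)
  rw [hσ] at hb
  set K₁ := 4 * ((∫ ω, (ε 0 ω ^ 2 - σ2) ^ 2 ∂μ) * σ2)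
        + 4 * ∫ ω, ((ε 0 ω ^ 2 - σ2) * ε 0 ω
          - ∫ ω', (ε 0 ω' ^ 2 - σ2) * ε 0 ω' ∂μ) ^ 2 ∂μ with hK₁
  set K₂ := 4 * (∫ ω, (ε 0 ω ^ 2 - σ2) * ε 0 ω ∂μ) ^ 2 with hK₂
  have hK₁0 : 0 ≤ K₁ := by
    have h1 : 0 ≤ ∫ ω, (ε 0 ω ^ 2 - σ2) ^ 2 ∂μ := integral_nonneg fun ω => sq_nonneg _
    have h2 : 0 ≤ ∫ ω, ((ε 0 ω ^ 2 - σ2) * ε 0 ω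
          - ∫ ω', (ε 0 ω' ^ 2 - σ2) * ε 0 ω' ∂μ) ^ 2 ∂μ := integral_nonneg fun ω => sq_nonneg _
    positivity
  have hK₂0 : 0 ≤ K₂ := by positivity
  have e : ∀ ω, linError n a b (fun i => ε i ω) ⬝ᵥ linError n a b (fun i => ε i ω)
      = ∑ r, (n : ℝ)⁻¹ ^ 2 * (∑ i ∈ range n, ∑ j ∈ range n,
        ((b j ⬝ᵥ a i) * a i r) * ((ε i ω ^ 2 - σ2) * ε j ω)) ^ 2 := by
    intro ω
    rw [dotProduct]
    refine sum_congr rfl fun r _ => ?_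
    rw [D.linError_apply]; ring
  simp_rw [e]
  have hi := fun r (_ : r ∈ (univ : Finset (Fin p))) => (hb r).1.const_mul ((n : ℝ)⁻¹ ^ 2)
  refine ⟨integrable_finsetSum _ hi, ?_⟩
  rw [integral_finsetSum _ hi]
  simp_rw [integral_const_mul]
  rw [← mul_sum]
  have hS1 : ∑ r, ∑ i ∈ range n, ∑ j ∈ range n, ((b j ⬝ᵥ a i) * a i r) ^ 2
      ≤ n ^ 2 * (L ^ 2 / (σ2 * C₀)) := by
    rw [sum_comm]
    calc ∑ i ∈ range n, ∑ r, ∑ j ∈ range n, ((b j ⬝ᵥ a i) * a i r) ^ 2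
        = ∑ i ∈ range n, (a i ⬝ᵥ a i) * ∑ j ∈ range n, (b j ⬝ᵥ a i) ^ 2 := by
          refine sum_congr rfl fun i _ => ?_
          rw [dotProduct, sum_mul_sum]
          exact sum_congr rfl fun r _ => sum_congr rfl fun j _ => by ring
      _ ≤ ∑ _i ∈ range n, L * (n * (L / (σ2 * C₀))) := sum_le_sum fun i hi =>
          mul_le_mul (D.bound i hi) (D.sum_sq_le hi) (sum_nonneg fun j _ => sq_nonneg _) hL.le
      _ = n ^ 2 * (L ^ 2 / (σ2 * C₀)) := by
          rw [sum_const, card_range, nsmul_eq_mul]; ring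
  -- The traces of the coordinate matrices form the single vector `∑ (b i · a i) • a i`, so they are
  -- estimated jointly rather than one coordinate at a time.
  have hS2 : ∑ r, (∑ i ∈ range n, (b i ⬝ᵥ a i) * a i r) ^ 2
      ≤ n ^ 2 * (C₁ / σ2 * (L / C₀) ^ 2) := by
    calc ∑ r, (∑ i ∈ range n, (b i ⬝ᵥ a i) * a i r) ^ 2
        = (∑ i ∈ range n, (b i ⬝ᵥ a i) • a i) ⬝ᵥ (∑ i ∈ range n, (b i ⬝ᵥ a i) • a i) := by
          rw [dotProduct]
          refine sum_congr rfl fun r _ => ?_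
          simp only [Finset.sum_apply, Pi.smul_apply, smul_eq_mul, sq]
      _ ≤ n * C₁ / σ2 * ∑ i ∈ range n, (b i ⬝ᵥ a i) ^ 2 := D.sum_smul_dotProduct_self_le _
      _ ≤ n * C₁ / σ2 * ∑ _i ∈ range n, (L / C₀) ^ 2 := by
          exact mul_le_mul_of_nonneg_left (sum_le_sum fun i hi => D.diag_sq_le hi) (by positivity)
      _ = n ^ 2 * (C₁ / σ2 * (L / C₀) ^ 2) := by
          rw [sum_const, card_range, nsmul_eq_mul]; ring
  calc (n : ℝ)⁻¹ ^ 2 * ∑ r, ∫ ω, (∑ i ∈ range n, ∑ j ∈ range n,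
        ((b j ⬝ᵥ a i) * a i r) * ((ε i ω ^ 2 - σ2) * ε j ω)) ^ 2 ∂μ
      ≤ (n : ℝ)⁻¹ ^ 2 * ∑ r, (K₁ * ∑ i ∈ range n, ∑ j ∈ range n, ((b j ⬝ᵥ a i) * a i r) ^ 2
        + K₂ * (∑ i ∈ range n, (b i ⬝ᵥ a i) * a i r) ^ 2) := by
        gcongr with r _
        exact (hb r).2
    _ = (n : ℝ)⁻¹ ^ 2 * (K₁ * ∑ r, ∑ i ∈ range n, ∑ j ∈ range n, ((b j ⬝ᵥ a i) * a i r) ^ 2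
        + K₂ * ∑ r, (∑ i ∈ range n, (b i ⬝ᵥ a i) * a i r) ^ 2) := by
        rw [sum_add_distrib, mul_sum, mul_sum]
    _ ≤ (n : ℝ)⁻¹ ^ 2 * (K₁ * (n ^ 2 * (L ^ 2 / (σ2 * C₀)))
        + K₂ * (n ^ 2 * (C₁ / σ2 * (L / C₀) ^ 2))) := by gcongr
    _ = _ := by field_simp

end DesignMoments

/-! ### Exceptional sets and rates. -/

section Asymptotic

variable {Ω : Type*} [MeasurableSpace Ω] {μ : Measure Ω} [IsProbabilityMeasure μ]

theorem tendsto_measure_ge_of_integral_le {f : ℕ → Ω → ℝ} {t B : ℕ → ℝ}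
    (h : ∀ᶠ n in atTop, 0 < t n ∧ (∀ ω, 0 ≤ f n ω) ∧ Integrable (f n) μ ∧ ∫ ω, f n ω ∂μ ≤ B n)
    (hB : Tendsto (fun n => B n / t n) atTop (𝓝 0)) :
    Tendsto (fun n => μ {ω | t n ≤ f n ω}) atTop (𝓝 0) := by
  have h1 : Tendsto (fun n => ENNReal.ofReal (B n / t n)) atTop (𝓝 0) := by
    simpa using ENNReal.tendsto_ofReal hB
  refine tendsto_of_tendsto_of_tendsto_of_le_of_le' tendsto_const_nhds h1
    (Eventually.of_forall fun n => zero_le) ?_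
  filter_upwards [h] with n hn
  obtain ⟨ht, h0, hi, hb⟩ := hn
  have h2 := mul_meas_ge_le_integral_of_nonneg (Eventually.of_forall h0) hi (t n)
  rw [← ofReal_measureReal]
  apply ENNReal.ofReal_le_ofReal
  rw [le_div_iff₀ ht, mul_comm]
  exact h2.trans hb

/-- Outside of a set of vanishing probability, the empirical likelihood problem is regular and the
statistic has the quadratic expansion. -/
theorem IsIID.exists_bad_sets {ε : ℕ → Ω → ℝ} (h : IsIID μ ε) {q σ2 C₀ C₁ K : ℝ} (hq : 4 ≤ q)
    (hK : 0 < K) (h8 : MemLp (ε 0) 8 μ) (hmq : Integrable (fun ω => |ε 0 ω| ^ (2 * q)) μ)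
    (hz : ∫ ω, ε 0 ω ∂μ = 0) (hσ : ∫ ω, ε 0 ω ^ 2 ∂μ = σ2) {p : ℕ → ℕ}
    (hp : ∀ᶠ n in atTop, 0 < p n) {a b : (n : ℕ) → ℕ → Fin (p n) → ℝ}
    (hD : ∀ᶠ n in atTop, IsDualDesign n (a n) (b n) σ2 C₀ C₁ (K * p n))
    (hpn : Tendsto (fun n => (p n : ℝ) * (n : ℝ) ^ ((2 - q) / (2 * q))) atTop (𝓝 0))
    {δ : ℝ} (hδ : 0 < δ) :
    ∃ bad : ℕ → Set Ω, Tendsto (fun n => μ (bad n)) atTop (𝓝 0) ∧ ∀ᶠ n in atTop, ∀ ω ∉ bad n,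
      (∀ v : Fin (p n) → ℝ,
        n * C₀ / 2 * (v ⬝ᵥ v) ≤ ∑ i ∈ range n, (v ⬝ᵥ (ε i ω • a n i)) ^ 2) ∧
      ∃ lam, IsOneSampleMultiplier (range n) (fun i => ε i ω • a n i) lam ∧
        ∀ y : Fin (p n) → ℝ,
          (∀ v : Fin (p n) → ℝ, ∑ i ∈ range n, (y ⬝ᵥ (ε i ω • a n i)) * (v ⬝ᵥ (ε i ω • a n i))
            = v ⬝ᵥ ∑ i ∈ range n, ε i ω • a n i) →
          |2 * ∑ i ∈ range n, Real.log (1 + lam ⬝ᵥ (ε i ω • a n i))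
            - y ⬝ᵥ ∑ i ∈ range n, ε i ω • a n i| ≤ δ * Real.sqrt (p n) := by
  have hq0 : (0 : ℝ) < q := by linarith
  have h4 : MemLp (ε 0) 4 μ := h8.mono_exponent (by norm_num)
  have h2 : MemLp (ε 0) 2 μ := h8.mono_exponent (by norm_num)
  have hn1 : ∀ᶠ n : ℕ in atTop, (1 : ℝ) ≤ n := by
    filter_upwards [eventually_ge_atTop 1] with n hn
    exact_mod_cast hn
  -- Two rates matter: `κ` governs existence of the multiplier, `ρ = p / √n` the remainders. As `(2
  -- - q) / (2 * q) ≥ -1 / 2`, the second is dominated by the first.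
  set κ : ℕ → ℝ := fun n => (p n : ℝ) * (n : ℝ) ^ ((2 - q) / (2 * q)) with hκ
  set ρ : ℕ → ℝ := fun n => (p n : ℝ) / Real.sqrt n with hρ
  have hρ0 : Tendsto ρ atTop (𝓝 0) := by
    refine tendsto_of_tendsto_of_tendsto_of_le_of_le' tendsto_const_nhds hpn
      (Eventually.of_forall fun n => by positivity) ?_
    filter_upwards [hn1] with n hn
    change (p n : ℝ) / Real.sqrt n ≤ _
    rw [div_eq_mul_inv, Real.sqrt_eq_rpow, ← Real.rpow_neg (by positivity)]
    refine mul_le_mul_of_nonneg_left (Real.rpow_le_rpow_of_exponent_le hn ?_) (by positivity)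
    rw [le_div_iff₀ (by positivity)]
    linarith
  have hρsq : ∀ n, ρ n ^ 2 = (p n : ℝ) ^ 2 / n := fun n => by
    simp only [hρ]
    rw [div_pow, Real.sq_sqrt (Nat.cast_nonneg n)]
  -- A bound for all `|ε i • a i|²` at once: outside the second exceptional set every `ε i ^ 2` is
  -- at most `n ^ (2 / q)`. The threshold `n²` there, against a mean of order `n`, makes Markov's
  -- bound vanish.
  set Mx : ℕ → ℝ := fun n => (n : ℝ) ^ (2 / q) * (K * p n) with hMx
  set Kη := ∫ ω, (ε 0 ω ^ 2 - σ2) ^ 2 ∂μ with hKη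
  set m := ∫ ω, |ε 0 ω| ^ (2 * q) ∂μ with hm
  set K4 := 8 * (∫ ω, ε 0 ω ^ 8 ∂μ + 3 * (∫ ω, ε 0 ω ^ 4 ∂μ) ^ 2) with hK4
  set K₁ := 4 * (Kη * σ2)
        + 4 * ∫ ω, ((ε 0 ω ^ 2 - σ2) * ε 0 ω
          - ∫ ω', (ε 0 ω' ^ 2 - σ2) * ε 0 ω' ∂μ) ^ 2 ∂μ with hK₁
  set K₂ := 4 * (∫ ω, (ε 0 ω ^ 2 - σ2) * ε 0 ω ∂μ) ^ 2 with hK₂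
  have T1 : Tendsto (fun n => μ {ω | (n * C₀ / 2) ^ 2 ≤ frobError n (a n) σ2 (fun i => ε i ω)})
      atTop (𝓝 0) := by
    refine tendsto_measure_ge_of_integral_le (B := fun n => Kη * (n * (K * p n) ^ 2)) ?_ ?_
    · filter_upwards [hD] with n D
      have hn := D.n_pos
      have hC := D.lower_pos
      exact ⟨by positivity, fun ω => sum_nonneg fun r _ => sum_nonneg fun s _ => sq_nonneg _,
        h.integral_frobError h4 hσ D⟩
    · have hlim : Tendsto (fun n => Kη * K ^ 2 * 4 / C₀ ^ 2 * ρ n ^ 2) atTop (𝓝 0) := by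
        simpa using (hρ0.pow 2).const_mul (Kη * K ^ 2 * 4 / C₀ ^ 2)
      refine hlim.congr' ?_
      filter_upwards [hD] with n D
      have hn := D.n_pos
      have hC := D.lower_pos
      rw [hρsq]
      field_simp
      ring
  have T2 : Tendsto (fun n : ℕ => μ {ω | (n : ℝ) ^ 2 ≤ ∑ i ∈ range n, |ε i ω| ^ (2 * q)})
      atTop (𝓝 0) := by
    have hg : Measurable (fun x : ℝ => |x| ^ (2 * q)) := by fun_prop
    refine tendsto_measure_ge_of_integral_le (B := fun n => n * m) ?_ ?_
    · filter_upwards [hD] with n D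
      have hn := D.n_pos
      have hi : ∀ i ∈ range n, Integrable (fun ω => |ε i ω| ^ (2 * q)) μ := fun i _ =>
        memLp_one_iff_integrable.1 (h.memLp_comp hg (memLp_one_iff_integrable.2 hmq) i)
      refine ⟨by positivity, fun ω => sum_nonneg fun i _ => by positivity,
        integrable_finsetSum _ hi, ?_⟩
      rw [integral_finsetSum _ hi, sum_congr rfl fun i _ => h.integral_comp hg i]
      simp [hm]
    · have hlim : Tendsto (fun n : ℕ => m / (n : ℝ)) atTop (𝓝 0) :=
        tendsto_const_div_atTop_nhds_zero_nat m
      refine hlim.congr' ?_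
      filter_upwards [hD] with n D
      have hn := D.n_pos
      field_simp
  have T3 : Tendsto (fun n => μ {ω | (n * C₀) ^ 2 ≤ 1296 * Mx n *
      ((∑ i ∈ range n, ε i ω • a n i) ⬝ᵥ (∑ i ∈ range n, ε i ω • a n i))}) atTop (𝓝 0) := by
    refine tendsto_measure_ge_of_integral_le
      (B := fun n => 1296 * Mx n * (σ2 * (n * (K * p n)))) ?_ ?_
    · filter_upwards [hD] with n D
      have hn := D.n_pos
      have hC := D.lower_pos
      have hb := h.integral_sum_dotProduct_self h2 hz hσ D
      have hMn : 0 ≤ 1296 * Mx n := by positivity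
      refine ⟨by positivity, fun ω => mul_nonneg hMn (dotProduct_self_nonneg' _),
        hb.1.const_mul _, ?_⟩
      rw [integral_const_mul]
      exact mul_le_mul_of_nonneg_left hb.2 hMn
    · have hlim : Tendsto (fun n => 1296 * K ^ 2 * σ2 / C₀ ^ 2 * κ n ^ 2) atTop (𝓝 0) := by
        simpa using (hpn.pow 2).const_mul (1296 * K ^ 2 * σ2 / C₀ ^ 2)
      refine hlim.congr' ?_
      filter_upwards [hD] with n D
      have hn := D.n_pos
      have hC := D.lower_pos
      -- The exponents satisfy `(2 - q) / q + 1 = 2 / q`, so the Markov ratio is exactly a multiple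
      -- of `κ²`.
      have hpow : ((n : ℝ) ^ ((2 - q) / (2 * q))) ^ 2 * n = (n : ℝ) ^ (2 / q) := by
        rw [← Real.rpow_natCast, ← Real.rpow_mul hn.le]
        nth_rewrite 2 [← Real.rpow_one (n : ℝ)]
        rw [← Real.rpow_add hn]
        congr 1
        push_cast
        field_simp
        ring
      simp only [hκ, hMx]
      rw [← hpow]
      field_simp
  have T4 : Tendsto (fun n => μ {ω | δ / 3 ≤ 52 / (n * C₀) *
      (linError n (a n) (b n) (fun i => ε i ω) ⬝ᵥ linError n (a n) (b n) (fun i => ε i ω))})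
      atTop (𝓝 0) := by
    refine tendsto_measure_ge_of_integral_le
      (B := fun n => 52 / (n * C₀) * (K₁ * ((K * p n) ^ 2 / (σ2 * C₀))
        + K₂ * (C₁ / σ2 * (K * p n / C₀) ^ 2))) ?_ ?_
    · filter_upwards [hD] with n D
      have hn := D.n_pos
      have hC := D.lower_pos
      have hb := h.integral_linError_sq h8 hz hσ D
      have hc : 0 ≤ 52 / (n * C₀) := by positivity
      refine ⟨by positivity, fun ω => mul_nonneg hc (dotProduct_self_nonneg' _),
        hb.1.const_mul _, ?_⟩
      rw [integral_const_mul]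
      exact mul_le_mul_of_nonneg_left hb.2 hc
    · have hlim : Tendsto (fun n => (52 / C₀ * (K₁ * (K ^ 2 / (σ2 * C₀))
        + K₂ * (C₁ / σ2 * (K / C₀) ^ 2))) / (δ / 3) * ρ n ^ 2) atTop (𝓝 0) := by
        simpa using (hρ0.pow 2).const_mul ((52 / C₀ * (K₁ * (K ^ 2 / (σ2 * C₀))
        + K₂ * (C₁ / σ2 * (K / C₀) ^ 2))) / (δ / 3))
      refine hlim.congr' ?_
      filter_upwards [hD] with n D
      have hn := D.n_pos
      have hC := D.lower_pos
      have hs := D.var_pos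
      rw [hρsq]
      field_simp
  have T5 : Tendsto (fun n => μ {ω | δ / 3 ≤ (100 + 4 / ρ n) *
      ∑ i ∈ range n, (pilot n (b n) (fun j => ε j ω) ⬝ᵥ (ε i ω • a n i)) ^ 4}) atTop (𝓝 0) := by
    refine tendsto_measure_ge_of_integral_le
      (B := fun n => (100 + 4 / ρ n) * (K4 * (K * p n / (σ2 * C₀)) ^ 2 / n)) ?_ ?_
    · filter_upwards [hD] with n D
      have hb := h.integral_sum_pilot_pow_four h8 hz D
      have hc : 0 ≤ 100 + 4 / ρ n := by positivity
      refine ⟨by positivity, fun ω => mul_nonneg hc (sum_nonneg fun i _ => by positivity),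
        hb.1.const_mul _, ?_⟩
      rw [integral_const_mul]
      exact mul_le_mul_of_nonneg_left hb.2 hc
    · have hlim : Tendsto (fun n => K4 * (K / (σ2 * C₀)) ^ 2 / (δ / 3)
          * (100 * ρ n ^ 2 + 4 * ρ n)) atTop (𝓝 0) := by
        simpa using ((((hρ0.pow 2).const_mul 100).add (hρ0.const_mul 4)).const_mul
          (K4 * (K / (σ2 * C₀)) ^ 2 / (δ / 3)))
      refine hlim.congr' ?_
      filter_upwards [hD, hp] with n D hpos
      have hn := D.n_pos
      have hC := D.lower_pos
      have hs := D.var_pos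
      have hp' : (0 : ℝ) < p n := by exact_mod_cast hpos
      have hρn : 0 < ρ n := div_pos hp' (Real.sqrt_pos.2 hn)
      have e1 : K4 * (K * p n / (σ2 * C₀)) ^ 2 / n = K4 * (K / (σ2 * C₀)) ^ 2 * ρ n ^ 2 := by
        rw [hρsq]; field_simp
      have e2 : (100 + 4 / ρ n) * ρ n ^ 2 = 100 * ρ n ^ 2 + 4 * ρ n := by
        field_simp
      rw [e1, ← e2]; ring
  refine ⟨fun n => {ω | (n * C₀ / 2) ^ 2 ≤ frobError n (a n) σ2 (fun i => ε i ω)}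
    ∪ ({ω | (n : ℝ) ^ 2 ≤ ∑ i ∈ range n, |ε i ω| ^ (2 * q)}
    ∪ ({ω | (n * C₀) ^ 2 ≤ 1296 * Mx n *
      ((∑ i ∈ range n, ε i ω • a n i) ⬝ᵥ (∑ i ∈ range n, ε i ω • a n i))}
    ∪ ({ω | δ / 3 ≤ 52 / (n * C₀) *
      (linError n (a n) (b n) (fun i => ε i ω) ⬝ᵥ linError n (a n) (b n) (fun i => ε i ω))}
    ∪ {ω | δ / 3 ≤ (100 + 4 / ρ n) *
      ∑ i ∈ range n, (pilot n (b n) (fun j => ε j ω) ⬝ᵥ (ε i ω • a n i)) ^ 4}))), ?_, ?_⟩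
  · have hsum := T1.add (T2.add (T3.add (T4.add T5)))
    simp only [add_zero] at hsum
    refine tendsto_of_tendsto_of_tendsto_of_le_of_le tendsto_const_nhds hsum
      (fun n => zero_le) (fun n => ?_)
    exact (measure_union_le _ _).trans (add_le_add le_rfl ((measure_union_le _ _).trans
      (add_le_add le_rfl ((measure_union_le _ _).trans (add_le_add le_rfl
        (measure_union_le _ _))))))
  · have hsmall : ∀ᶠ n in atTop, 4 * ρ n < δ / 3 :=
      (hρ0.const_mul 4).eventually_lt_const (by simpa using by positivity)
    filter_upwards [hD, hp, hsmall] with n D hpos hsm ω hω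
    simp only [Set.mem_union, Set.mem_ofPred_eq, not_or, not_le] at hω
    obtain ⟨b1, b2, b3, b4, b5⟩ := hω
    have hn := D.n_pos
    have hp' : (1 : ℝ) ≤ p n := by exact_mod_cast hpos
    have hp0 : (0 : ℝ) < p n := by linarith
    have hρn : 0 < ρ n := div_pos hp0 (Real.sqrt_pos.2 hn)
    have hsp : 1 ≤ Real.sqrt (p n) := Real.one_le_sqrt.2 hp'
    have hMn : 0 < Mx n := by positivity
    have hmax : ∀ i ∈ range n, ε i ω ^ 2 * (K * p n) ≤ Mx n := by
      intro i hi
      have h1 : |ε i ω| ^ (2 * q) < (n : ℝ) ^ 2 :=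
        lt_of_le_of_lt (single_le_sum (f := fun i => |ε i ω| ^ (2 * q))
          (fun j _ => by positivity) hi) b2
      have h2 : ε i ω ^ 2 ≤ (n : ℝ) ^ (2 / q) := by
        have h3 := Real.rpow_le_rpow (by positivity) h1.le (by positivity : 0 ≤ 1 / q)
        rw [← Real.rpow_mul (abs_nonneg _), ← Real.rpow_natCast (n : ℝ) 2,
          ← Real.rpow_mul hn.le] at h3
        have e1 : 2 * q * (1 / q) = ((2 : ℕ) : ℝ) := by field_simp; norm_num
        have e2 : ((2 : ℕ) : ℝ) * (1 / q) = 2 / q := by push_cast; ring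
        rw [e1, e2, Real.rpow_natCast, sq_abs] at h3
        exact h3
      exact mul_le_mul_of_nonneg_right h2 (by positivity)
    refine ⟨D.lower_of_frobError_le b1.le, ?_⟩
    -- For `τ = ρ / √p` one has `n τ³ = ρ √p`, while `(4 / τ) ρ² = 4 ρ √p`: the two sides of the
    -- cubic trade-off have the same order.
    have hτ : 0 < ρ n / Real.sqrt (p n) := by positivity
    obtain ⟨lam, hlam, hexp⟩ := D.expansion hMn hτ b1.le hmax b3
    refine ⟨lam, hlam, fun y hy => (hexp y hy).trans ?_⟩
    have e3 : (n : ℝ) * (ρ n / Real.sqrt (p n)) ^ 3 = ρ n * Real.sqrt (p n) := by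
      have hs : Real.sqrt (p n) ^ 2 = p n := Real.sq_sqrt hp0.le
      have hs0 : Real.sqrt (p n) ≠ 0 := by positivity
      have h5 : (n : ℝ) * ρ n ^ 2 = Real.sqrt (p n) ^ 2 * Real.sqrt (p n) ^ 2 := by
        rw [hρsq, hs]; field_simp
      calc (n : ℝ) * (ρ n / Real.sqrt (p n)) ^ 3
          = ρ n * (n * ρ n ^ 2) / Real.sqrt (p n) ^ 3 := by ring
        _ = ρ n * Real.sqrt (p n) := by rw [h5]; field_simp
    have h6 : (100 + 4 / (ρ n / Real.sqrt (p n)))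
        * ∑ i ∈ range n, (pilot n (b n) (fun j => ε j ω) ⬝ᵥ (ε i ω • a n i)) ^ 4 ≤
        δ / 3 * Real.sqrt (p n) := by
      have h40 : 0 ≤ ∑ i ∈ range n, (pilot n (b n) (fun j => ε j ω) ⬝ᵥ (ε i ω • a n i)) ^ 4 :=
        sum_nonneg fun i _ => by positivity
      have h7 : 100 + 4 / (ρ n / Real.sqrt (p n)) ≤ (100 + 4 / ρ n) * Real.sqrt (p n) := by
        have : 4 / (ρ n / Real.sqrt (p n)) = 4 / ρ n * Real.sqrt (p n) := by field_simp
        rw [this]; nlinarith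
      calc _ ≤ (100 + 4 / ρ n) * Real.sqrt (p n)
            * ∑ i ∈ range n, (pilot n (b n) (fun j => ε j ω) ⬝ᵥ (ε i ω • a n i)) ^ 4 := by gcongr
        _ = ((100 + 4 / ρ n)
            * ∑ i ∈ range n, (pilot n (b n) (fun j => ε j ω) ⬝ᵥ (ε i ω • a n i)) ^ 4)
              * Real.sqrt (p n) := by ring
        _ ≤ _ := by gcongr
    rw [e3]
    nlinarith

end Asymptotic

/-! ### Merging the two phases into one sample. -/

section Reduction

variable {p : ℕ}

/-- The signed weight by which the two phases are merged into one sample. -/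
noncomputable def phaseWeight (n k i : ℕ) : ℝ :=
  if i < k then 1 / theta n k else -(1 / (1 - theta n k))

theorem sum_range_eq_add {E : Type*} [AddCommMonoid E] {n k : ℕ} (hkn : k ≤ n) {f g h : ℕ → E}
    (h₁ : ∀ i ∈ range k, f i = g i) (h₂ : ∀ i ∈ Ico k n, f i = h i) :
    ∑ i ∈ range n, f i = ∑ i ∈ range k, g i + ∑ i ∈ Ico k n, h i := by
  rw [← sum_range_add_sum_Ico f hkn, sum_congr rfl h₁, sum_congr rfl h₂]

theorem phaseWeight_first {n k i : ℕ} (hi : i ∈ range k) :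
    phaseWeight n k i = 1 / theta n k := if_pos (mem_range.1 hi)

theorem phaseWeight_second {n k i : ℕ} (hi : i ∈ Ico k n) :
    phaseWeight n k i = -(1 / (1 - theta n k)) := if_neg (not_lt.2 (mem_Ico.1 hi).1)

theorem psi_eq {n k : ℕ} (hkn : k ≤ n) (z : ℕ → Fin p → ℝ) :
    psi n k z = (n : ℝ)⁻¹ • ∑ i ∈ range n, phaseWeight n k i • z i := by
  rw [sum_range_eq_add hkn (g := fun i => (1 / theta n k) • z i)
    (h := fun i => (-(1 / (1 - theta n k))) • z i)
    (fun i hi => by rw [phaseWeight_first hi]) (fun i hi => by rw [phaseWeight_second hi]),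
    ← smul_sum, ← smul_sum, smul_add, smul_smul, smul_smul, psi, sub_eq_add_neg, ← neg_smul]
  congr 2 <;> rw [one_div, one_div, mul_inv]
  ring

theorem secondMoment_eq {n k : ℕ} (hkn : k ≤ n) (z : ℕ → Fin p → ℝ) :
    secondMoment n k z = (n : ℝ)⁻¹ • ∑ i ∈ range n,
      vecMulVec (phaseWeight n k i • z i) (phaseWeight n k i • z i) := by
  rw [sum_range_eq_add hkn (g := fun i => (1 / theta n k) ^ 2 • vecMulVec (z i) (z i))
    (h := fun i => (-(1 / (1 - theta n k))) ^ 2 • vecMulVec (z i) (z i))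
    (fun i hi => by rw [phaseWeight_first hi, smul_vecMulVec, vecMulVec_smul, smul_smul, sq])
    (fun i hi => by rw [phaseWeight_second hi, smul_vecMulVec, vecMulVec_smul, smul_smul, sq]),
    ← smul_sum, ← smul_sum, smul_add, smul_smul, smul_smul, secondMoment]
  congr 2 <;> rw [one_div, one_div, mul_inv]
  · rw [inv_pow]
  · rw [neg_sq, inv_pow]

theorem meanSecondMoment_eq (n k : ℕ) (x : ℕ → Fin p → ℝ) (σ : ℝ) :
    meanSecondMoment n k x σ = σ ^ 2 • secondMoment n k x := by
  rw [meanSecondMoment, secondMoment, ← smul_sum, ← smul_sum, smul_add, smul_comm (σ ^ 2),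
    smul_comm (σ ^ 2)]

theorem secondMoment_mulVec {n k : ℕ} (hkn : k ≤ n) (z : ℕ → Fin p → ℝ) (v : Fin p → ℝ) :
    (n : ℝ) • secondMoment n k z *ᵥ v = ((n : ℝ) * (n : ℝ)⁻¹) • ∑ i ∈ range n,
      (v ⬝ᵥ (phaseWeight n k i • z i)) • (phaseWeight n k i • z i) := by
  rw [secondMoment_eq hkn, smul_mulVec, smul_smul, sum_mulVec]
  congr 1
  refine sum_congr rfl fun i _ => ?_
  rw [vecMulVec_mulVec, dotProduct_comm]
  ext; simp [mul_comm]

theorem dotProduct_secondMoment_mulVec {n k : ℕ} (hkn : k ≤ n) (hn : (n : ℝ) ≠ 0)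
    (z : ℕ → Fin p → ℝ) (v w : Fin p → ℝ) :
    n * (w ⬝ᵥ secondMoment n k z *ᵥ v) = ∑ i ∈ range n,
      (v ⬝ᵥ (phaseWeight n k i • z i)) * (w ⬝ᵥ (phaseWeight n k i • z i)) := by
  have := congrArg (fun y => w ⬝ᵥ y) (secondMoment_mulVec hkn z v)
  simpa only [mul_inv_cancel₀ hn, one_smul, dotProduct_smul, dotProduct_sum, smul_eq_mul] using this

/-- The denominators factor as `θ (1 + lam · u i)` and `(1 - θ) (1 + lam · u i)`. The prefactors
turn `z i` into `u i`, and the sign of the second weight absorbs the minus sign between the sums. -/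
theorem isLagrangeMultiplier_iff {n k : ℕ} (hkn : k ≤ n) (h0 : 0 < theta n k)
    (h1 : theta n k < 1) {z u : ℕ → Fin p → ℝ}
    (hu : ∀ i ∈ range n, phaseWeight n k i • z i = u i) (lam : Fin p → ℝ) :
    IsLagrangeMultiplier n k z lam ↔ IsOneSampleMultiplier (range n) u lam := by
  have h1' : 0 < 1 - theta n k := by linarith
  have hsub : ∀ i ∈ range k, i ∈ range n := fun i hi =>
    mem_range.2 ((mem_range.1 hi).trans_le hkn)
  have hsub' : ∀ i ∈ Ico k n, i ∈ range n := fun i hi => mem_range.2 (mem_Ico.1 hi).2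
  have e₁ : ∀ i ∈ range k, theta n k + lam ⬝ᵥ z i = theta n k * (1 + lam ⬝ᵥ u i) := by
    intro i hi
    rw [← hu i (hsub i hi), phaseWeight_first hi, dotProduct_smul, smul_eq_mul]
    field_simp
  have e₂ : ∀ i ∈ Ico k n,
      1 - theta n k - lam ⬝ᵥ z i = (1 - theta n k) * (1 + lam ⬝ᵥ u i) := by
    intro i hi
    rw [← hu i (hsub' i hi), phaseWeight_second hi, dotProduct_smul, smul_eq_mul]
    field_simp
    ring
  have hscore : ∑ i ∈ range k, (1 / (theta n k + lam ⬝ᵥ z i)) • z i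
      - ∑ j ∈ Ico k n, (1 / (1 - theta n k - lam ⬝ᵥ z j)) • z j
      = ∑ i ∈ range n, (1 / (1 + lam ⬝ᵥ u i)) • u i := by
    rw [sub_eq_add_neg, ← sum_neg_distrib]
    refine (sum_range_eq_add hkn (fun i hi => ?_) (fun i hi => ?_)).symm
    · rw [e₁ i hi, ← hu i (hsub i hi), phaseWeight_first hi, smul_smul]
      congr 1
      rw [one_div, one_div, one_div, mul_inv, mul_comm]
    · rw [e₂ i hi, ← hu i (hsub' i hi), phaseWeight_second hi, smul_smul, ← neg_smul]
      congr 1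
      rw [one_div, one_div, one_div, mul_inv]; ring
  constructor
  · intro h
    refine ⟨fun i hi => ?_, by rw [← hscore]; exact h.score_eq⟩
    by_cases hik : i < k
    · have := h.pos_first i (mem_range.2 hik)
      rw [e₁ i (mem_range.2 hik)] at this
      exact pos_of_mul_pos_right this h0.le
    · have hi' : i ∈ Ico k n := mem_Ico.2 ⟨not_lt.1 hik, mem_range.1 hi⟩
      have := h.pos_second i hi'
      rw [e₂ i hi'] at this
      exact pos_of_mul_pos_right this h1'.le
  · intro h
    refine ⟨fun i hi => ?_, fun i hi => ?_, by rw [hscore]; exact h.score_eq⟩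
    · rw [e₁ i hi]
      exact mul_pos h0 (h.pos i (hsub i hi))
    · rw [e₂ i hi]
      exact mul_pos h1' (h.pos i (hsub' i hi))

/-- The multiplier is defined by choice, so only uniqueness identifies it with the constructed one.
-/
theorem lagrangeMultiplier_eq {n k : ℕ} {z : ℕ → Fin p → ℝ} {lam : Fin p → ℝ}
    (h : IsLagrangeMultiplier n k z lam)
    (huniq : ∀ l, IsLagrangeMultiplier n k z l → l = lam) : lagrangeMultiplier n k z = lam := by
  have hex : ∃ l, IsLagrangeMultiplier n k z l := ⟨lam, h⟩
  rw [lagrangeMultiplier, dif_pos hex]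
  exact huniq _ hex.choose_spec

theorem empLik_eq {n k : ℕ} (hkn : k ≤ n) (hn : (n : ℝ) ≠ 0) {z u : ℕ → Fin p → ℝ}
    (hu : ∀ i ∈ range n, phaseWeight n k i • z i = u i) :
    empLik n k z = 2 * ∑ i ∈ range n, Real.log (1 + lagrangeMultiplier n k z ⬝ᵥ u i) := by
  rw [empLik, ← mul_add]
  congr 1
  refine (sum_range_eq_add hkn (fun i hi => ?_) (fun i hi => ?_)).symm
  · rw [← hu i (mem_range.2 ((mem_range.1 hi).trans_le hkn)), phaseWeight_first hi,
      dotProduct_smul, smul_eq_mul, theta, one_div_div]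
  · rw [← hu i (mem_range.2 (mem_Ico.1 hi).2), phaseWeight_second hi,
      dotProduct_smul, smul_eq_mul, theta, one_sub_div hn, one_div_div]
    congr 1
    ring

open scoped MatrixOrder in
-- Spectral bounds are Loewner bounds by scalar matrices, tested on `v`.
theorem dotProduct_mulVec_bounds {A : Matrix (Fin p) (Fin p) ℝ} (hA : A.IsHermitian) {C₀ C₁ : ℝ}
    (h : ∀ r, C₀ < hA.eigenvalues r ∧ hA.eigenvalues r < C₁) (v : Fin p → ℝ) :
    C₀ * (v ⬝ᵥ v) ≤ v ⬝ᵥ A *ᵥ v ∧ v ⬝ᵥ A *ᵥ v ≤ C₁ * (v ⬝ᵥ v) := by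
  have h1 : algebraMap ℝ _ C₀ ≤ A := by
    rw [algebraMap_le_iff_le_spectrum (a := A) (ha := hA), hA.spectrum_real_eq_range_eigenvalues]
    rintro _ ⟨i, rfl⟩
    exact (h i).1.le
  have h2 : A ≤ algebraMap ℝ _ C₁ := by
    rw [le_algebraMap_iff_spectrum_le (a := A) (ha := hA), hA.spectrum_real_eq_range_eigenvalues]
    rintro _ ⟨i, rfl⟩
    exact (h i).2.le
  have e : ∀ c : ℝ, v ⬝ᵥ (algebraMap ℝ (Matrix (Fin p) (Fin p) ℝ) c) *ᵥ v = c * (v ⬝ᵥ v) := by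
    intro c
    rw [Algebra.algebraMap_eq_smul_one, smul_mulVec, one_mulVec, dotProduct_smul, smul_eq_mul]
  have p1 := (Matrix.le_iff.1 h1).dotProduct_mulVec_nonneg v
  have p2 := (Matrix.le_iff.1 h2).dotProduct_mulVec_nonneg v
  rw [star_trivial, sub_mulVec, dotProduct_sub, e] at p1 p2
  constructor <;> linarith

theorem isUnit_of_dotProduct_mulVec_pos {A : Matrix (Fin p) (Fin p) ℝ} {c : ℝ} (hc : 0 < c)
    (h : ∀ v, c * (v ⬝ᵥ v) ≤ v ⬝ᵥ A *ᵥ v) : IsUnit A := by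
  rw [← mulVec_injective_iff_isUnit, ← coe_mulVecLin, ← LinearMap.ker_eq_bot,
    LinearMap.ker_eq_bot']
  intro v hv
  rw [mulVecLin_apply] at hv
  have h1 := h v
  rw [hv, dotProduct_zero] at h1
  exact dotProduct_self_eq_zero.1 (le_antisymm (by nlinarith) (dotProduct_self_nonneg' v))

/-- The merged design satisfies the assumptions of the one-sample theory. -/
theorem isDualDesign_of_bounds {n k : ℕ} (hn : 0 < n) (hkn : k ≤ n) (hp : 0 < p)
    {x : ℕ → Fin p → ℝ} {σ C₀ C₁ L : ℝ} (hC₀ : 0 < C₀)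
    (hC : ∀ r, C₀ < (meanSecondMoment_isHermitian n k x σ).eigenvalues r ∧
      (meanSecondMoment_isHermitian n k x σ).eigenvalues r < C₁)
    (hL : 0 < L) (hb : ∀ i ∈ range n, (phaseWeight n k i • x i) ⬝ᵥ (phaseWeight n k i • x i) ≤ L) :
    IsDualDesign n (fun i => phaseWeight n k i • x i)
      (fun i => (meanSecondMoment n k x σ)⁻¹ *ᵥ (phaseWeight n k i • x i)) (σ ^ 2) C₀ C₁ L := by
  have hn0 : (0 : ℝ) < n := by exact_mod_cast hn
  set V := meanSecondMoment n k x σ with hV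
  have hVB := dotProduct_mulVec_bounds (meanSecondMoment_isHermitian n k x σ) hC
  have hunit : IsUnit V := isUnit_of_dotProduct_mulVec_pos hC₀ fun v => (hVB v).1
  have hform : ∀ v, n * (v ⬝ᵥ V *ᵥ v)
      = σ ^ 2 * ∑ i ∈ range n, (v ⬝ᵥ (phaseWeight n k i • x i)) ^ 2 := by
    intro v
    rw [hV, meanSecondMoment_eq, smul_mulVec, dotProduct_smul, smul_eq_mul, mul_left_comm,
      dotProduct_secondMoment_mulVec hkn hn0.ne']
    simp_rw [sq (v ⬝ᵥ _)]
  have hlow : ∀ v : Fin p → ℝ, n * C₀ * (v ⬝ᵥ v)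
      ≤ σ ^ 2 * ∑ i ∈ range n, (v ⬝ᵥ (phaseWeight n k i • x i)) ^ 2 := by
    intro v
    rw [← hform, mul_assoc]
    exact mul_le_mul_of_nonneg_left (hVB v).1 hn0.le
  refine ⟨hn0, ?_, hC₀, ?_, hL, fun i hi => ?_, hlow, fun v => ?_, hb⟩
  -- Positivity of `σ²` is forced by the eigenvalue bound: if it vanished, the form would be zero at
  -- a vector that is nonzero because `0 < p`.
  · have h1 := hlow (fun _ => 1)
    have h3 : (0 : ℝ) < (fun _ : Fin p => (1 : ℝ)) ⬝ᵥ (fun _ => 1) := by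
      simpa [dotProduct] using hp
    have h4 := mul_pos (mul_pos hn0 hC₀) h3
    refine (sq_nonneg σ).lt_of_ne fun h0 => ?_
    rw [← h0, zero_mul] at h1
    linarith
  · have := hC ⟨0, hp⟩
    linarith
  · have h1 : V *ᵥ (V⁻¹ *ᵥ (phaseWeight n k i • x i)) = phaseWeight n k i • x i := by
      rw [mulVec_mulVec, mul_nonsing_inv _ ((isUnit_iff_isUnit_det _).1 hunit), one_mulVec]
    have h2 := secondMoment_mulVec hkn x (V⁻¹ *ᵥ (phaseWeight n k i • x i))
    rw [mul_inv_cancel₀ hn0.ne', one_smul] at h2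
    rw [← h2, smul_comm, ← smul_mulVec (σ ^ 2), ← meanSecondMoment_eq, ← hV, h1]
  · rw [← hform, mul_assoc]
    exact mul_le_mul_of_nonneg_left (hVB v).2 hn0.le

end Reduction

/-! ### From the assumptions to the one-sample theory. -/

section Main

variable {Ω : Type*} [MeasurableSpace Ω] {μ : Measure Ω} [IsProbabilityMeasure μ]

/-- The conclusion for a single sample. -/
theorem expansion_of_regular {n k p : ℕ} (hkn : k ≤ n) (h0 : 0 < theta n k)
    (h1 : theta n k < 1) (hn : 0 < n) {C₀ B : ℝ} (hC₀ : 0 < C₀) {x z : ℕ → Fin p → ℝ} {e : ℕ → ℝ}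
    (hz : ∀ i ∈ range n, z i = e i • x i)
    (hlow : ∀ v : Fin p → ℝ,
      n * C₀ / 2 * (v ⬝ᵥ v) ≤ ∑ i ∈ range n, (v ⬝ᵥ (e i • phaseWeight n k i • x i)) ^ 2)
    {lam : Fin p → ℝ}
    (hlam : IsOneSampleMultiplier (range n) (fun i => e i • phaseWeight n k i • x i) lam)
    (hexp : ∀ y : Fin p → ℝ,
      (∀ v : Fin p → ℝ, ∑ i ∈ range n, (y ⬝ᵥ (e i • phaseWeight n k i • x i))
        * (v ⬝ᵥ (e i • phaseWeight n k i • x i))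
          = v ⬝ᵥ ∑ i ∈ range n, e i • phaseWeight n k i • x i) →
      |2 * ∑ i ∈ range n, Real.log (1 + lam ⬝ᵥ (e i • phaseWeight n k i • x i))
        - y ⬝ᵥ ∑ i ∈ range n, e i • phaseWeight n k i • x i| ≤ B) :
    (∃! lam : Fin p → ℝ, IsLagrangeMultiplier n k z lam) ∧
    IsUnit (secondMoment n k (fun i => e i • x i)) ∧
    |empLik n k z - n * (psi n k (fun i => e i • x i) ⬝ᵥ
      ((secondMoment n k (fun i => e i • x i))⁻¹ *ᵥ psi n k (fun i => e i • x i)))| ≤ B := by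
  have hn0 : (0 : ℝ) < n := by exact_mod_cast hn
  have hu : ∀ i ∈ range n, phaseWeight n k i • z i = e i • phaseWeight n k i • x i := by
    intro i hi
    rw [hz i hi, smul_comm]
  have hpos : 0 < n * C₀ / 2 := by positivity
  have hiff := isLagrangeMultiplier_iff hkn h0 h1 hu
  have hlam' := (hiff lam).2 hlam
  have huniq : ∀ l, IsLagrangeMultiplier n k z l → l = lam := fun l hl =>
    IsOneSampleMultiplier.unique hpos hlow ((hiff l).1 hl) hlam
  set S := secondMoment n k (fun i => e i • x i) with hS
  set ψ := psi n k (fun i => e i • x i) with hψ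
  have hform : ∀ v w : Fin p → ℝ, n * (w ⬝ᵥ S *ᵥ v) = ∑ i ∈ range n,
      (v ⬝ᵥ (e i • phaseWeight n k i • x i)) * (w ⬝ᵥ (e i • phaseWeight n k i • x i)) := by
    intro v w
    rw [hS, dotProduct_secondMoment_mulVec hkn hn0.ne']
    exact sum_congr rfl fun i _ => by rw [smul_comm]
  have hunit : IsUnit S := by
    refine isUnit_of_dotProduct_mulVec_pos (c := C₀ / 2) (by positivity) fun v => ?_
    have h2 := hlow v
    simp_rw [sq (v ⬝ᵥ _)] at h2
    rw [← hform] at h2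
    refine le_of_mul_le_mul_left ?_ hn0
    calc n * (C₀ / 2 * (v ⬝ᵥ v)) = n * C₀ / 2 * (v ⬝ᵥ v) := by ring
      _ ≤ _ := h2
  have hψ' : ∑ i ∈ range n, e i • phaseWeight n k i • x i = (n : ℝ) • ψ := by
    rw [hψ, psi_eq hkn, smul_smul, mul_inv_cancel₀ hn0.ne', one_smul]
    exact sum_congr rfl fun i _ => smul_comm _ _ _
  refine ⟨⟨lam, hlam', huniq⟩, hunit, ?_⟩
  have hfin := hexp (S⁻¹ *ᵥ ψ) fun v => by
    rw [← hform, mulVec_mulVec, mul_nonsing_inv _ ((isUnit_iff_isUnit_det _).1 hunit), one_mulVec,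
      hψ', dotProduct_smul, smul_eq_mul]
  rw [hψ', dotProduct_smul, smul_eq_mul, dotProduct_comm (S⁻¹ *ᵥ ψ)] at hfin
  rw [empLik_eq hkn hn0.ne' hu, lagrangeMultiplier_eq hlam' huniq]
  exact hfin

/-- Pointwise `t² ≤ 1 + |t|^q`; this gives the order `p` of the squared norms of the regressors. -/
theorem dotProduct_self_le_of_rpow_mean {p : ℕ} (hp : 0 < p) {v : Fin p → ℝ} {q C : ℝ} (hq : 2 ≤ q)
    (h : ((p : ℝ))⁻¹ * ∑ s, |v s| ^ q < C) : v ⬝ᵥ v ≤ (1 + C) * p := by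
  have hp0 : (0 : ℝ) < p := by exact_mod_cast hp
  have h1 : ∑ s, |v s| ^ q ≤ C * p := by
    rw [inv_mul_lt_iff₀ hp0] at h
    linarith
  calc v ⬝ᵥ v ≤ ∑ s, (1 + |v s| ^ q) := by
        refine sum_le_sum fun s _ => ?_
        rw [← abs_mul_abs_self, ← sq]
        rcases le_total (|v s|) 1 with h2 | h2
        · have : |v s| ^ 2 ≤ 1 := pow_le_one₀ (abs_nonneg _) h2
          have : 0 ≤ |v s| ^ q := by positivity
          linarith
        · have : |v s| ^ 2 ≤ |v s| ^ q := by
            rw [← Real.rpow_natCast]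
            exact Real.rpow_le_rpow_of_exponent_le h2 (by exact_mod_cast hq)
          linarith
    _ = p + ∑ s, |v s| ^ q := by simp [sum_add_distrib]
    _ ≤ (1 + C) * p := by linarith

theorem memLp_eight_of_integrable_rpow {f : Ω → ℝ} (hf : AEStronglyMeasurable f μ) {q : ℝ}
    (hq : 4 ≤ q) (h : Integrable (fun ω => |f ω| ^ (2 * q)) μ) : MemLp f 8 μ := by
  have h1 : MemLp f (ENNReal.ofReal (2 * q)) μ := by
    rw [← integrable_norm_rpow_iff hf (by simp; linarith) ENNReal.ofReal_ne_top,
      ENNReal.toReal_ofReal (by linarith)]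
    exact h
  refine h1.mono_exponent ?_
  rw [show (8 : ℝ≥0∞) = ENNReal.ofReal 8 by simp]
  exact ENNReal.ofReal_le_ofReal (by linarith)

theorem eventually_isDualDesign {p k : ℕ → ℕ} {X : (n : ℕ) → ℕ → Fin (p n) → ℝ} {σ q : ℝ}
    (hq : 2 ≤ q) (hp : Tendsto p atTop atTop)
    (hθ : ∃ θ₀ ∈ Set.Ioo (0 : ℝ) 1, Tendsto (fun n => theta n (k n)) atTop (𝓝 θ₀))
    (hk : ∀ᶠ n in atTop, k n ≤ n)
    (hA1 : EigenvaluesBounded p k X σ) (hA3 : DesignBounded p X q) :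
    ∃ C₀ C₁ K : ℝ, 0 < C₀ ∧ 0 < K ∧ ∀ᶠ n in atTop,
      IsDualDesign n (fun i => phaseWeight n (k n) i • X n i)
        (fun i => (meanSecondMoment n (k n) (X n) σ)⁻¹ *ᵥ (phaseWeight n (k n) i • X n i))
        (σ ^ 2) C₀ C₁ (K * p n) := by
  obtain ⟨C₀, C₁, hC₀, hC⟩ := hA1
  obtain ⟨C₃, hC₃, hX⟩ := hA3
  obtain ⟨θ₀, ⟨hθ0, hθ1⟩, hθ⟩ := hθ
  have hθ1' : 0 < 1 - θ₀ := by linarith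
  -- Bounds the squared phase weights once `θ₀ / 2 < θ < (1 + θ₀) / 2`.
  set W := (2 / θ₀) ^ 2 + (2 / (1 - θ₀)) ^ 2 with hW
  have hW0 : 0 < W := by positivity
  refine ⟨C₀, C₁, W * (1 + C₃), hC₀, by positivity, ?_⟩
  filter_upwards [hC, hX, hk, hp.eventually_gt_atTop 0, eventually_gt_atTop 0,
    hθ.eventually_const_lt (show θ₀ / 2 < θ₀ by linarith),
    hθ.eventually_lt_const (show θ₀ < (1 + θ₀) / 2 by linarith)] with n hCn hXn hkn hpn hn ht1 ht2
  have hpn0 : (0 : ℝ) < p n := by exact_mod_cast hpn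
  refine isDualDesign_of_bounds hn hkn hpn hC₀ hCn (by positivity) fun i hi => ?_
  rw [dotProduct_smul_self, mul_assoc]
  refine mul_le_mul ?_ (dotProduct_self_le_of_rpow_mean hpn hq (hXn i hi))
    (dotProduct_self_nonneg' _) hW0.le
  rw [phaseWeight]
  split_ifs
  · have : 1 / theta n (k n) ≤ 2 / θ₀ := by
      rw [div_le_div_iff₀ (by linarith) hθ0]; linarith
    have h2 : (1 / theta n (k n)) ^ 2 ≤ (2 / θ₀) ^ 2 :=
      pow_le_pow_left₀ (one_div_nonneg.2 (by linarith)) this 2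
    have := sq_nonneg (2 / (1 - θ₀))
    linarith
  · have : 1 / (1 - theta n (k n)) ≤ 2 / (1 - θ₀) := by
      rw [div_le_div_iff₀ (by linarith) hθ1']; linarith
    have h2 : (1 / (1 - theta n (k n))) ^ 2 ≤ (2 / (1 - θ₀)) ^ 2 :=
      pow_le_pow_left₀ (one_div_nonneg.2 (by linarith)) this 2
    have := sq_nonneg (2 / θ₀)
    rw [neg_sq]
    linarith

end Main

end TwoSampleEL

theorem proposition3 {Ω : Type*} [MeasurableSpace Ω] (μ : Measure Ω) [IsProbabilityMeasure μ]
    (p k : ℕ → ℕ) (X : (n : ℕ) → ℕ → Fin (p n) → ℝ) (β₀ β₂ : (n : ℕ) → Fin (p n) → ℝ) (σ : ℝ)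
    (ε : ℕ → Ω → ℝ) (Y : ℕ → ℕ → Ω → ℝ)
    (hmodel : TwoSampleEL.TwoPhaseModel μ p k X β₀ β₂ σ ε Y)
    (hH0 : β₂ = β₀)
    (q : ℝ) (hq : 4 ≤ q)
    (hA1 : TwoSampleEL.EigenvaluesBounded p k X σ)
    (hA2 : Integrable (fun ω => ε 0 ω ^ 4) μ)
    (hA3 : TwoSampleEL.DesignBounded p X q)
    (hA4 : Integrable (fun ω => |ε 0 ω| ^ (2 * q)) μ)
    (hA5 : Tendsto (fun n => (p n : ℝ) * (k n : ℝ) ^ ((2 - q) / (2 * q))) atTop (𝓝 0) ∧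
      Tendsto (fun n => (p n : ℝ) * ((n : ℝ) - k n) ^ ((2 - q) / (2 * q))) atTop (𝓝 0))
    (hA6 : Tendsto (fun n => (p n : ℝ) ^ (2 + 4 / q) * (k n : ℝ)⁻¹) atTop (𝓝 0) ∧
      Tendsto (fun n => (p n : ℝ) ^ (2 + 4 / q) * ((n : ℝ) - k n)⁻¹) atTop (𝓝 0))
    (hA7 : TwoSampleEL.FourthMomentCondition p fun n _ t =>
      TwoSampleEL.alpha μ n (k n) (X n) σ
        (fun ω => TwoSampleEL.score (X n) (fun i => Y n i ω) (β₀ n)) t)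
    (hA8 : TwoSampleEL.ThirdMomentCondition p fun n _ t =>
      TwoSampleEL.alpha μ n (k n) (X n) σ
        (fun ω => TwoSampleEL.score (X n) (fun i => Y n i ω) (β₀ n)) t) :
    -- the multiplier exists and is unique, with probability tending to one
    TwoSampleEL.WithProbTendingToOne μ (fun n ω => ∃! lam : Fin (p n) → ℝ,
      TwoSampleEL.IsLagrangeMultiplier n (k n)
        (TwoSampleEL.score (X n) (fun i => Y n i ω) (β₀ n)) lam) ∧
    -- the second-moment matrix is invertible, with probability tending to one
    TwoSampleEL.WithProbTendingToOne μ (fun n ω =>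
      IsUnit (TwoSampleEL.secondMoment n (k n) (fun i => ε i ω • X n i))) ∧
    -- the expansion of the statistic
    TwoSampleEL.IsLittleOP μ
      (fun n ω =>
        TwoSampleEL.empLik n (k n) (TwoSampleEL.score (X n) (fun i => Y n i ω) (β₀ n))
          - n * (TwoSampleEL.psi n (k n) (fun i => ε i ω • X n i) ⬝ᵥ
              ((TwoSampleEL.secondMoment n (k n) (fun i => ε i ω • X n i))⁻¹ *ᵥ
                TwoSampleEL.psi n (k n) (fun i => ε i ω • X n i))))
      (fun n => (p n : ℝ) ^ (1 / 2 : ℝ)) := by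
  have hiid : TwoSampleEL.IsIID μ ε := ⟨hmodel.indep, hmodel.ident⟩
  have h8 := TwoSampleEL.memLp_eight_of_integrable_rpow
    (hiid.aemeasurable 0).aestronglyMeasurable hq hA4
  have hz := hmodel.mean_zero
  have hσ : ∫ ω, ε 0 ω ^ 2 ∂μ = σ ^ 2 := by
    rw [← hmodel.variance_eq, variance_of_integral_eq_zero (hiid.aemeasurable 0) hz]
  obtain ⟨θ₀, ⟨hθ0, hθ1⟩, hθ⟩ := hmodel.change_point
  have hn1 : ∀ᶠ n : ℕ in atTop, 0 < n := eventually_gt_atTop 0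
  have ht0 : ∀ᶠ n in atTop, 0 < TwoSampleEL.theta n (k n) := hθ.eventually_const_lt hθ0
  have ht1 : ∀ᶠ n in atTop, TwoSampleEL.theta n (k n) < 1 := hθ.eventually_lt_const hθ1
  have hkn : ∀ᶠ n in atTop, k n ≤ n := by
    filter_upwards [hn1, ht1] with n hn ht
    rw [TwoSampleEL.theta, div_lt_one (by exact_mod_cast hn)] at ht
    exact_mod_cast ht.le
  have hk0 : ∀ᶠ n in atTop, 0 < k n := by
    filter_upwards [ht0] with n ht
    refine Nat.pos_of_ne_zero fun h0 => ?_
    rw [TwoSampleEL.theta, h0] at ht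
    simp at ht
  -- The exponent is nonpositive and `k ≤ n`, so the rate in `k` implies the rate in `n`.
  have hpn : Tendsto (fun n => (p n : ℝ) * (n : ℝ) ^ ((2 - q) / (2 * q))) atTop (𝓝 0) := by
    refine tendsto_of_tendsto_of_tendsto_of_le_of_le' tendsto_const_nhds hA5.1
      (Eventually.of_forall fun n => by positivity) ?_
    filter_upwards [hkn, hk0] with n h1 h2
    refine mul_le_mul_of_nonneg_left ?_ (Nat.cast_nonneg _)
    refine Real.rpow_le_rpow_of_nonpos (by exact_mod_cast h2) (by exact_mod_cast h1) ?_
    exact div_nonpos_of_nonpos_of_nonneg (by linarith) (by linarith)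
  have hp := hmodel.dim_tendsto.eventually_gt_atTop 0
  obtain ⟨C₀, C₁, K, hC₀, hK, hD⟩ := TwoSampleEL.eventually_isDualDesign (by linarith)
    hmodel.dim_tendsto hmodel.change_point hkn hA1 hA3
  have key : ∀ δ : ℝ, 0 < δ → ∃ bad : ℕ → Set Ω, Tendsto (fun n => μ (bad n)) atTop (𝓝 0) ∧
      ∀ᶠ n in atTop, ∀ ω ∉ bad n,
        (∃! lam : Fin (p n) → ℝ, TwoSampleEL.IsLagrangeMultiplier n (k n)
          (TwoSampleEL.score (X n) (fun i => Y n i ω) (β₀ n)) lam) ∧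
        IsUnit (TwoSampleEL.secondMoment n (k n) (fun i => ε i ω • X n i)) ∧
        |TwoSampleEL.empLik n (k n) (TwoSampleEL.score (X n) (fun i => Y n i ω) (β₀ n))
          - n * (TwoSampleEL.psi n (k n) (fun i => ε i ω • X n i) ⬝ᵥ
              ((TwoSampleEL.secondMoment n (k n) (fun i => ε i ω • X n i))⁻¹ *ᵥ
                TwoSampleEL.psi n (k n) (fun i => ε i ω • X n i)))| ≤
          δ * (p n : ℝ) ^ (1 / 2 : ℝ) := by
    intro δ hδ
    obtain ⟨bad, hbad, hgood⟩ := hiid.exists_bad_sets hq hK h8 hA4 hz hσ hp hD hpn hδ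
    refine ⟨bad, hbad, ?_⟩
    filter_upwards [hgood, hn1, ht0, ht1, hkn] with n hg hn h0 h1 hk ω hω
    obtain ⟨hlow, lam, hlam, hexp⟩ := hg ω hω
    rw [← Real.sqrt_eq_rpow]
    refine TwoSampleEL.expansion_of_regular hk h0 h1 hn hC₀ (fun i hi => ?_) hlow hlam hexp
    have hY : Y n i ω = X n i ⬝ᵥ β₀ n + ε i ω := by
      by_cases hik : i < k n
      · exact hmodel.first_phase n i (mem_range.2 hik) ω
      · rw [hmodel.second_phase n i (mem_Ico.2 ⟨not_lt.1 hik, mem_range.1 hi⟩) ω, hH0]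
    rw [TwoSampleEL.score, hY, add_sub_cancel_left]
  -- All three conclusions hold off the same exceptional set, so each failure event is contained in
  -- it; only monotonicity of `μ` is used, so no measurability of the events is needed.
  have lift : ∀ {δ : ℝ} (_ : 0 < δ) {P : ℕ → Set Ω}, (∀ bad : ℕ → Set Ω,
      (∀ᶠ n in atTop, ∀ ω ∉ bad n,
        (∃! lam : Fin (p n) → ℝ, TwoSampleEL.IsLagrangeMultiplier n (k n)
          (TwoSampleEL.score (X n) (fun i => Y n i ω) (β₀ n)) lam) ∧
        IsUnit (TwoSampleEL.secondMoment n (k n) (fun i => ε i ω • X n i)) ∧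
        |TwoSampleEL.empLik n (k n) (TwoSampleEL.score (X n) (fun i => Y n i ω) (β₀ n))
          - n * (TwoSampleEL.psi n (k n) (fun i => ε i ω • X n i) ⬝ᵥ
              ((TwoSampleEL.secondMoment n (k n) (fun i => ε i ω • X n i))⁻¹ *ᵥ
                TwoSampleEL.psi n (k n) (fun i => ε i ω • X n i)))| ≤
          δ * (p n : ℝ) ^ (1 / 2 : ℝ)) → ∀ᶠ n in atTop, P n ⊆ bad n) →
      Tendsto (fun n => μ (P n)) atTop (𝓝 0) := by
    intro δ hδ P hP
    obtain ⟨bad, hbad, hgood⟩ := key δ hδ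
    refine tendsto_of_tendsto_of_tendsto_of_le_of_le' tendsto_const_nhds hbad
      (Eventually.of_forall fun n => zero_le) ?_
    filter_upwards [hP bad hgood] with n hn
    exact measure_mono hn
  refine ⟨lift one_pos fun bad hbad => ?_, lift one_pos fun bad hbad => ?_,
    fun δ hδ => lift hδ fun bad hbad => ?_⟩
  · filter_upwards [hbad] with n hn ω hω
    by_contra hb
    exact hω (hn ω hb).1
  · filter_upwards [hbad] with n hn ω hω
    by_contra hb
    exact hω (hn ω hb).2.1
  · filter_upwards [hbad] with n hn ω hω
    by_contra hb
    exact not_lt.2 (hn ω hb).2.2 hω
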